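/- **Setting.** Let $K$ be a field, $R=K[x_1,\dots,x_n]\subset S=K[x_0,x_1,\dots,x_n]$ with $x_0<x_1<\dots<x_n$. For a monomial ideal $J$ let $B_J$ be its minimal monomial generating set and $\mathcal N(J)$ the set of monomials not in $J$. A monomial ideal is *strongly stable* if, whenever a monomial $x^\alpha x_i$ belongs to it and $x_j>x_i$, also $x^\alpha x_j$ belongs to it. Let $\mathfrak j\subset R$ be strongly stable, let $m\ge 1$ be an integer, let $\mathfrak j^h\subset S$ be the homogenization of $\mathfrak j$ and $J=(\mathfrak j^h)_{\ge m}$ its truncation in degrees $\geq m$. For $x^\alpha\in B_{\mathfrak j}$ put $d_\alpha=\max\{m,|\alpha|\}$. For a commutative $K$-algebra $A$, a *$[\mathfrak j,m]$-marked set over $A$* is a family $\mathfrak G=\{f_\alpha=x^\alpha-T_\alpha\}_{x^\alpha\in B_{\mathfrak j}}$ in $A[x_1,\dots,x_n]$ with $\operatorname{supp}(T_\alpha)\subseteq\mathcal N(\mathfrak j)_{\le d_\alpha}$. It is a *$[\mathfrak j,m]$-marked basis* if $A[x_1,\dots,x_n]_{\le t}=\langle\mathcal N(\mathfrak j)_{\le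 t}\rangle_A\oplus(\mathfrak G)_{\le t}$ for all $t\ge m$. Let $\mathcal M\mathrm f(\mathfrak j,m)(A)$ be the set of ideals generated by a $[\mathfrak j,m]$-marked basis over $A$, and let $\mathcal M\mathrm f(J)(A)$ be the set of homogeneous ideals $I\subset A[x_0,\dots,x_n]$ with $A[x_0,\dots,x_n]=I\oplus\langle\mathcal N(J)\rangle_A$. For $A=K$ these are the families $\mathcal M\mathrm f(\mathfrak j,m)$ and $\mathcal M\mathrm f(J)$. Let $C=\{C_{\alpha\gamma}\}$ be variables indexed by $x^\alpha\in B_{\mathfrak j}$, $x^\gamma\in\mathcal N(\mathfrak j)_{\le d_\alpha}$, and let $\mathfrak G=\{f_\alpha=x^\alpha-\sum_\gamma C_{\alpha\gamma}x^\gamma\}\subset K[C][x_1,\dots,x_n]$ be the generic $[\mathfrak j,m]$-marked set. A polynomial is *reduced* if no monomial of its support lies in $\mathfrak j$. A *reduction step* replaces $g$ by $g-c\,x^\eta f_\alpha$, where $x^\gamma\in\operatorname{supp}(g)\cap\mathfrak j$ has coefficient $c$ in $g$, and $x^\gamma=x^\alpha x^\eta$ with $x^\alpha\in B_{\mathfrak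 j}$ and every variable of $x^\eta$ at most every variable of $x^\alpha$. Let $\mathfrak A\subset K[C]$ be the ideal generated by * $\mathcal D_1$: the coefficients of the monomials of degree $>m$ in the reduced polynomials obtained by such reduction steps from the monomials $x^\beta\in\mathfrak j_{\le m}\setminus B_{\mathfrak j}$; * $\mathcal D_2$: the coefficients of all reduced polynomials in the ideal generated by $\mathfrak G$ in $K[C][x_1,\dots,x_n]$. In the same way let $C'=\{C'_{\alpha\gamma}\}$ be variables indexed by $x^\alpha\in B_J$, $x^\gamma\in\mathcal N(J)$ with $|\gamma|=|\alpha|$, let $G=\{x^\alpha-\sum_\gamma C'_{\alpha\gamma}x^\gamma\}$ be the generic $J$-marked set, and let $\mathfrak A_J\subset K[C']$ be the ideal generated by the coefficients of all polynomials in $(G)K[C'][x_0,\dots,x_n]$ none of whose monomials lies in $J$. This ideal defines the scheme structure of $\mathcal M\mathrm f(J)$. **Theorem.** 1. For every commutative $K$-algebra $A$, sending a point $c$ to the ideal generated by $\mathfrak G$ with $C$ specialized to $c$ is a bijection from the $A$-points of the closed subscheme $\operatorname{Spec}(K[C]/\mathfrak A)$ of affine space onto $\mathcal M\mathrm f(\mathfrak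 j,m)(A)$. Thus $\mathcal M\mathrm f(\mathfrak j,m)$ is endowed with the structure of the affine scheme $\operatorname{Spec}(K[C]/\mathfrak A)$. 2. In the same way, for every $A$ the $A$-points of $\operatorname{Spec}(K[C']/\mathfrak A_J)$ are in bijection with $\mathcal M\mathrm f(J)(A)$ by specializing $G$. 3. For every $A$, $\mathfrak i\mapsto(\mathfrak i^h)_{\ge m}$ is a bijection $\mathcal M\mathrm f(\mathfrak j,m)(A)\to\mathcal M\mathrm f(J)(A)$, with inverse the dehomogenization $I\mapsto I^a$ ($x_0\mapsto1$). 4. $\mathcal M\mathrm f(\mathfrak j,m)=\mathcal M\mathrm f\big((\mathfrak j^h)_{\ge m}\big)$ scheme-theoretically: identify $C_{\alpha\gamma}$ with the variable $C'$ whose head term is $x_0^{d_\alpha-|\alpha|}x^\alpha$ and whose tail monomial is $x_0^{d_\alpha-|\gamma|}x^\gamma$ (these monomials are respectively in $B_J$ and in $\mathcal N(J)$); the resulting projection $\operatorname{Spec}K[C']\to\operatorname{Spec}K[C]$ restricts to an isomorphism of schemes $\operatorname{Spec}(K[C']/\mathfrak A_J)\cong\operatorname{Spec}(K[C]/\mathfrak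 A)$; $\mathfrak A=\mathfrak A_J\cap K[C]$; and on $A$-points, for every $A$, this isomorphism is the inverse of the bijection in 3. -/

import Mathlib

open MvPolynomial AlgebraicGeometry CategoryTheory

universe u v

namespace MarkedFamily

noncomputable section

/-! ### Monomials, strongly stable ideals

A monomial is represented by its exponent. The variables `x₁ < … < xₙ` of `R = K[x₁, …, xₙ]` are
indexed by `Fin n`, the variables `x₀ < x₁ < … < xₙ` of `S = K[x₀, …, xₙ]` by `Fin (n + 1)`. -/

/-- The exponents of the monomials that belong to the ideal `J`. -/
def monomialsIn {K : Type u} [Field K] {n : ℕ} (J : Ideal (MvPolynomial (Fin n) K)) :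
    Set (Fin n →₀ ℕ) :=
  {γ | monomial γ (1 : K) ∈ J}

/-- The monomial basis `B_J`: the monomials of `J` that are minimal for divisibility. -/
def monomialBasis {K : Type u} [Field K] {n : ℕ} (J : Ideal (MvPolynomial (Fin n) K)) :
    Set (Fin n →₀ ℕ) :=
  {α | Minimal (fun β => β ∈ monomialsIn J) α}

/-- `J` is generated by monomials. -/
def IsMonomialIdeal {K : Type u} [Field K] {n : ℕ} (J : Ideal (MvPolynomial (Fin n) K)) : Prop :=
  J = Ideal.span ((fun γ : Fin n →₀ ℕ => monomial γ (1 : K)) '' monomialsIn J)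

/-- `x^β` is obtained from `x^α` by an increasing elementary move: `x^α x_j = x^β x_i`, `i < j`. -/
def IncreasingMove {n : ℕ} (α β : Fin n →₀ ℕ) : Prop :=
  ∃ i j : Fin n, i < j ∧ α + Finsupp.single j 1 = β + Finsupp.single i 1

/-- `BorelLT α β` is `x^α <_B x^β`. -/
def BorelLT {n : ℕ} (α β : Fin n →₀ ℕ) : Prop :=
  Relation.TransGen IncreasingMove α β

def IsStronglyStable {K : Type u} [Field K] {n : ℕ} (J : Ideal (MvPolynomial (Fin n) K)) : Prop :=
  IsMonomialIdeal J ∧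
    ∀ α β : Fin n →₀ ℕ, β ∈ monomialsIn J → BorelLT β α → α ∈ monomialsIn J

/-- `x^γ = x^α *_J x^η`: `γ = α + η`, `x^α ∈ B_J` and `max (x^η) ≤ min (x^α)`. -/
def IsStarDecomposition {K : Type u} [Field K] {n : ℕ} (J : Ideal (MvPolynomial (Fin n) K))
    (γ α η : Fin n →₀ ℕ) : Prop :=
  γ = α + η ∧ α ∈ monomialBasis J ∧ ∀ k ∈ η.support, ∀ i ∈ α.support, k ≤ i

/-! ### Marked sets with coefficients in a ring

`B` is the set of head terms, and `T α` is the finite set of monomials that are allowed in the tail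
of the polynomial with head term `x^α`. -/

/-- The exponents of total degree `d`. -/
def expsEq (n d : ℕ) : Finset (Fin n →₀ ℕ) :=
  Finset.finsuppAntidiag Finset.univ d

theorem mem_expsEq {n d : ℕ} {γ : Fin n →₀ ℕ} : γ ∈ expsEq n d ↔ γ.degree = d := by
  simp [expsEq, Finsupp.degree_eq_sum]

/-- The exponents of total degree at most `d`. -/
def expsLE (n d : ℕ) : Finset (Fin n →₀ ℕ) :=
  (Finset.range (d + 1)).biUnion (expsEq n)

theorem mem_expsLE {n d : ℕ} {γ : Fin n →₀ ℕ} : γ ∈ expsLE n d ↔ γ.degree ≤ d := by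
  simp [expsLE, mem_expsEq]

/-- The pairs `(α, γ)` that index the coefficients of the tails. -/
abbrev CoeffIdx {n : ℕ} (B : Set (Fin n →₀ ℕ)) (T : (Fin n →₀ ℕ) → Finset (Fin n →₀ ℕ)) : Type :=
  Σ α : {α : Fin n →₀ ℕ // α ∈ B}, {γ : Fin n →₀ ℕ // γ ∈ T α.1}

/-- The polynomials `f_α = x^α - ∑_γ c_{αγ} x^γ`. -/
def markedPoly {A : Type v} [CommRing A] {n : ℕ} {B : Set (Fin n →₀ ℕ)}
    {T : (Fin n →₀ ℕ) → Finset (Fin n →₀ ℕ)} (c : CoeffIdx B T → A) (α : {α // α ∈ B}) :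
    MvPolynomial (Fin n) A :=
  monomial α.1 1 - ∑ γ : {γ // γ ∈ T α.1}, monomial γ.1 (c ⟨α, γ⟩)

/-- The ideal generated by the polynomials `markedPoly c α`. -/
def markedIdeal {A : Type v} [CommRing A] {n : ℕ} {B : Set (Fin n →₀ ℕ)}
    {T : (Fin n →₀ ℕ) → Finset (Fin n →₀ ℕ)} (c : CoeffIdx B T → A) :
    Ideal (MvPolynomial (Fin n) A) :=
  Ideal.span (Set.range (markedPoly c))

/-- A polynomial with coefficients in any ring is reduced if no monomial of its support is in `J`. -/
def IsReducedPoly {K : Type u} [Field K] {n : ℕ} (J : Ideal (MvPolynomial (Fin n) K))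
    {A : Type v} [CommRing A] (p : MvPolynomial (Fin n) A) : Prop :=
  ∀ γ ∈ p.support, γ ∉ monomialsIn J

/-- The `A`-valued solutions of the polynomial equations given by an ideal `a`, that is, the
`A`-points of the closed subscheme of affine space that `a` defines. -/
def points {K : Type u} [Field K] {C : Type} (a : Ideal (MvPolynomial C K))
    (A : Type v) [CommRing A] [Algebra K A] : Set (C → A) :=
  {c | ∀ p ∈ a, aeval c p = 0}

/-! ### The non-homogeneous case -/

/-- The monomials of `N(j)` of degree at most `max {m, |α|}`. -/
def affTail {K : Type u} [Field K] {n : ℕ} (j : Ideal (MvPolynomial (Fin n) K)) (m : ℕ)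
    (α : Fin n →₀ ℕ) : Finset (Fin n →₀ ℕ) :=
  open Classical in (expsLE n (max m α.degree)).filter (fun γ => γ ∉ monomialsIn j)

/-- A `[j,m]`-marked set with coefficients in `A`, indexed by its head terms: the tail
`x^α - F α` is supported on `N(j)_{≤ t}` with `t = max {m, |α|}`. -/
def IsAffMarkedSet {K : Type u} [Field K] {n : ℕ} (j : Ideal (MvPolynomial (Fin n) K)) (m : ℕ)
    {A : Type v} [CommRing A] (F : {α // α ∈ monomialBasis j} → MvPolynomial (Fin n) A) : Prop :=
  ∀ α : {α // α ∈ monomialBasis j}, ∀ γ ∈ (monomial α.1 1 - F α).support,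
    γ ∉ monomialsIn j ∧ γ.degree ≤ max m (α.1).degree

/-- A `[j,m]`-marked basis with coefficients in `A`: a `[j,m]`-marked set `F` such that
`A[x₁, …, xₙ]_{≤ t} = ⟨N(j)_{≤ t}⟩ ⊕ (F)_{≤ t}` as `A`-modules for all `t ≥ m`. -/
def IsAffMarkedBasis {K : Type u} [Field K] {n : ℕ} (j : Ideal (MvPolynomial (Fin n) K)) (m : ℕ)
    {A : Type v} [CommRing A] (F : {α // α ∈ monomialBasis j} → MvPolynomial (Fin n) A) : Prop :=
  IsAffMarkedSet j m F ∧ ∀ t, m ≤ t →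
    let N : Submodule A (MvPolynomial (Fin n) A) := Submodule.span A
      {p | ∃ γ : Fin n →₀ ℕ, γ ∉ monomialsIn j ∧ γ.degree ≤ t ∧ p = monomial γ 1}
    let I : Submodule A (MvPolynomial (Fin n) A) :=
      (Ideal.span (Set.range F)).restrictScalars A ⊓ restrictTotalDegree (Fin n) A t
    Disjoint N I ∧ N ⊔ I = restrictTotalDegree (Fin n) A t

/-- The `[j,m]`-marked family with coefficients in `A`; for `A = K` it is `Mf(j,m)`. -/
def affFamily {K : Type u} [Field K] {n : ℕ} (j : Ideal (MvPolynomial (Fin n) K)) (m : ℕ)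
    (A : Type v) [CommRing A] : Set (Ideal (MvPolynomial (Fin n) A)) :=
  {I | ∃ F : {α // α ∈ monomialBasis j} → MvPolynomial (Fin n) A,
    IsAffMarkedBasis j m F ∧ I = Ideal.span (Set.range F)}

/-- The index set of the variables `C`. -/
abbrev AffIdx {K : Type u} [Field K] {n : ℕ} (j : Ideal (MvPolynomial (Fin n) K)) (m : ℕ) : Type :=
  CoeffIdx (monomialBasis j) (affTail j m)

/-- One step of the reduction by the marked polynomials `F α`. -/
def ReductionStep {K : Type u} [Field K] {n : ℕ} (j : Ideal (MvPolynomial (Fin n) K))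
    {A : Type v} [CommRing A] (F : {α // α ∈ monomialBasis j} → MvPolynomial (Fin n) A)
    (g g₁ : MvPolynomial (Fin n) A) : Prop :=
  ∃ (γ : Fin n →₀ ℕ) (α : {α // α ∈ monomialBasis j}) (η : Fin n →₀ ℕ),
    γ ∈ g.support ∧ IsStarDecomposition j γ α.1 η ∧ g₁ = g - monomial η (coeff γ g) * F α

/-- `g` can be reduced to `g₁`, in finitely many steps. -/
def ReducesTo {K : Type u} [Field K] {n : ℕ} (j : Ideal (MvPolynomial (Fin n) K))
    {A : Type v} [CommRing A] (F : {α // α ∈ monomialBasis j} → MvPolynomial (Fin n) A)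
    (g g₁ : MvPolynomial (Fin n) A) : Prop :=
  Relation.ReflTransGen (ReductionStep j F) g g₁

/-- The generic `[j,m]`-marked set, whose coefficients are the variables `C`. -/
def affGeneric {K : Type u} [Field K] {n : ℕ} (j : Ideal (MvPolynomial (Fin n) K)) (m : ℕ) :
    {α // α ∈ monomialBasis j} → MvPolynomial (Fin n) (MvPolynomial (AffIdx j m) K) :=
  markedPoly (X : AffIdx j m → MvPolynomial (AffIdx j m) K)

/-- The coefficients in degree `> m` of the reduced forms of the monomials `x^β` with
`x^β ∈ j_{≤ m} \ B_j`. -/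
def D₁ {K : Type u} [Field K] {n : ℕ} (j : Ideal (MvPolynomial (Fin n) K)) (m : ℕ) :
    Set (MvPolynomial (AffIdx j m) K) :=
  {a | ∃ (β : Fin n →₀ ℕ) (g : MvPolynomial (Fin n) (MvPolynomial (AffIdx j m) K))
      (γ : Fin n →₀ ℕ),
    β ∈ monomialsIn j ∧ β.degree ≤ m ∧ β ∉ monomialBasis j ∧
    ReducesTo j (affGeneric j m) (monomial β 1) g ∧ IsReducedPoly j g ∧
    m < γ.degree ∧ a = coeff γ g}

/-- The coefficients of the reduced polynomials of the ideal generated by the generic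
`[j,m]`-marked set. -/
def D₂ {K : Type u} [Field K] {n : ℕ} (j : Ideal (MvPolynomial (Fin n) K)) (m : ℕ) :
    Set (MvPolynomial (AffIdx j m) K) :=
  {a | ∃ (p : MvPolynomial (Fin n) (MvPolynomial (AffIdx j m) K)) (γ : Fin n →₀ ℕ),
    p ∈ Ideal.span (Set.range (affGeneric j m)) ∧ IsReducedPoly j p ∧ a = coeff γ p}

/-- The ideal `𝔄 ⊆ K[C]`. -/
def affIdeal {K : Type u} [Field K] {n : ℕ} (j : Ideal (MvPolynomial (Fin n) K)) (m : ℕ) :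
    Ideal (MvPolynomial (AffIdx j m) K) :=
  Ideal.span (D₁ j m ∪ D₂ j m)

/-! ### The homogeneous case -/

/-- The monomials of `N(J)` of degree `|α|`. -/
def homTail {K : Type u} [Field K] {n : ℕ} (J : Ideal (MvPolynomial (Fin n) K))
    (α : Fin n →₀ ℕ) : Finset (Fin n →₀ ℕ) :=
  open Classical in (expsEq n α.degree).filter (fun γ => γ ∉ monomialsIn J)

/-- The `J`-marked family with coefficients in `A`: the homogeneous ideals `I` such that
`A[x] = I ⊕ ⟨N(J)⟩` as `A`-modules, that is, `N(J)` is a basis of `A[x] / I`. -/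
def homFamily {K : Type u} [Field K] {n : ℕ} (J : Ideal (MvPolynomial (Fin n) K))
    (A : Type v) [CommRing A] : Set (Ideal (MvPolynomial (Fin n) A)) :=
  {I | (∀ F ∈ I, ∀ t, homogeneousComponent t F ∈ I) ∧
    IsCompl (I.restrictScalars A) (Submodule.span A
      {p : MvPolynomial (Fin n) A | ∃ γ : Fin n →₀ ℕ, γ ∉ monomialsIn J ∧ p = monomial γ 1})}

/-- The index set of the coefficients of the generic `J`-marked set. -/
abbrev HomIdx {K : Type u} [Field K] {n : ℕ} (J : Ideal (MvPolynomial (Fin n) K)) : Type :=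
  CoeffIdx (monomialBasis J) (homTail J)

/-- The ideal that defines the `J`-marked scheme: it is generated by the coefficients of the reduced
polynomials of the ideal generated by the generic `J`-marked set. -/
def homIdeal {K : Type u} [Field K] {n : ℕ} (J : Ideal (MvPolynomial (Fin n) K)) :
    Ideal (MvPolynomial (HomIdx J) K) :=
  Ideal.span {a | ∃ (p : MvPolynomial (Fin n) (MvPolynomial (HomIdx J) K)) (γ : Fin n →₀ ℕ),
    p ∈ markedIdeal (X : HomIdx J → MvPolynomial (HomIdx J) K) ∧ IsReducedPoly J p ∧
    a = coeff γ p}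

/-! ### Homogenization, dehomogenization, truncation -/

/-- `f^h = x₀^{deg f} f(x₁/x₀, …, xₙ/x₀)`. -/
def homogenization {A : Type v} [CommRing A] {n : ℕ} (f : MvPolynomial (Fin n) A) :
    MvPolynomial (Fin (n + 1)) A :=
  ∑ γ ∈ f.support, monomial (Finsupp.cons (f.totalDegree - γ.degree) γ) (coeff γ f)

/-- `I^h`, generated by the homogenizations of all the polynomials of `I`. -/
def homogenizationIdeal {A : Type v} [CommRing A] {n : ℕ} (I : Ideal (MvPolynomial (Fin n) A)) :
    Ideal (MvPolynomial (Fin (n + 1)) A) :=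
  Ideal.span {F | ∃ f ∈ I, F = homogenization f}

/-- `F ↦ F^a`: replace `x₀` by `1`. -/
def dehomogenization (A : Type v) [CommRing A] (n : ℕ) :
    MvPolynomial (Fin (n + 1)) A →ₐ[A] MvPolynomial (Fin n) A :=
  aeval (Fin.cons 1 X : Fin (n + 1) → MvPolynomial (Fin n) A)

/-- `I^a`. -/
def dehomogenizationIdeal {A : Type v} [CommRing A] {n : ℕ}
    (I : Ideal (MvPolynomial (Fin (n + 1)) A)) : Ideal (MvPolynomial (Fin n) A) :=
  I.map (dehomogenization A n)

/-- The truncation `I_{≥ m}` of a homogeneous ideal. -/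
def truncation {A : Type v} [CommRing A] {n : ℕ} (I : Ideal (MvPolynomial (Fin n) A)) (m : ℕ) :
    Ideal (MvPolynomial (Fin n) A) :=
  Ideal.span {F | F ∈ I ∧ ∃ t, m ≤ t ∧ F.IsHomogeneous t}

/-! ### The schemes -/

/-- The affine scheme `Spec (K[C] / a)`. -/
def closedSubscheme {K : Type u} [Field K] {C : Type} (a : Ideal (MvPolynomial C K)) : Scheme.{u} :=
  Spec (CommRingCat.of (MvPolynomial C K ⧸ a))

/-- The closed immersion of `Spec (K[C] / a)` into the affine space `Spec K[C]`. -/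
def closedSubschemeEmb {K : Type u} [Field K] {C : Type} (a : Ideal (MvPolynomial C K)) :
    closedSubscheme a ⟶ Spec (CommRingCat.of (MvPolynomial C K)) :=
  Spec.map (CommRingCat.ofHom (Ideal.Quotient.mk a))

/-- The projection of affine spaces that keeps the coordinates with index in the image of `ι`. -/
def coordProjection (K : Type u) [Field K] {C C' : Type} (ι : C → C') :
    Spec (CommRingCat.of (MvPolynomial C' K)) ⟶ Spec (CommRingCat.of (MvPolynomial C K)) :=
  Spec.map (CommRingCat.ofHom (rename ι : MvPolynomial C K →ₐ[K] MvPolynomial C' K).toRingHom)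

/-- The affine scheme `Mf(j,m)`. -/
abbrev affScheme {K : Type u} [Field K] {n : ℕ} (j : Ideal (MvPolynomial (Fin n) K)) (m : ℕ) :
    Scheme.{u} :=
  closedSubscheme (affIdeal j m)

/-- The affine scheme `Mf(J)`. -/
abbrev homScheme {K : Type u} [Field K] {n : ℕ} (J : Ideal (MvPolynomial (Fin n) K)) :
    Scheme.{u} :=
  closedSubscheme (homIdeal J)

end

end MarkedFamily

/-! Strong stability gives every monomial of the ideal exactly one star decomposition `x^α * x^η`.
Rewriting it by `f_α` can only create monomials of the ideal whose cofactor is strictly smaller than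
`x^η` in the well-order `revLex`; degrees play no role, so tails of degree larger than their heads
are harmless. Hence reduction terminates (`exists_reducesTo`), and for the same reason a combination
of the star products `x^η f_α` is reduced only if it is zero (`eq_zero_of_mem_starSpan`). If the
coefficients of the reduced polynomials of the generic ideal vanish at `c`, the star products span
the whole specialized ideal. So these equations say exactly that the ideal of `c` contains no
nonzero reduced polynomial, that is, reduced forms modulo it are unique. This describes the points
of `homIdeal`; for `affIdeal`, the equations `D₁` add that monomials of `j_{≤ m}` have reduced forms
of degree at most `m` (`mem_points_affIdeal`).

The two sides are compared through the generators of `J`: each has degree `m`, or is free of `x₀`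
and lies in `B_j`. Thus the coordinates forgotten by the projection belong to heads of degree `m`.
On a point of `homIdeal` these heads, dehomogenized, give the degree bound of `D₁`; conversely that
bound lets the missing tails be written down by homogenizing reduced forms (`hasBoundedReduction`,
`exists_comp_idx_eq`). Dehomogenization carries the ideal of `c` to that of its projection, and
truncated homogenization carries it back, so the projection is also injective on points.

The projection is therefore bijective on points over every algebra. Applying this to the universal
points of the two coordinate rings, as in Yoneda's lemma, gives an isomorphism of these rings, from
which the scheme isomorphism and the equality of ideals follow. -/

namespace MarkedFamily

/-! ### Star decompositions: existence, uniqueness, descent of cofactors. -/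

section StarDecomposition

variable {K : Type u} [Field K] {n : ℕ} {J : Ideal (MvPolynomial (Fin n) K)}

theorem mem_monomialsIn_of_le {γ δ : Fin n →₀ ℕ} (h : γ ∈ monomialsIn J) (hle : γ ≤ δ) :
    δ ∈ monomialsIn J := by
  have : (monomial δ (1 : K)) = monomial (δ - γ) 1 * monomial γ 1 := by
    rw [monomial_mul, tsub_add_cancel_of_le hle, one_mul]
  change monomial δ (1 : K) ∈ J
  rw [this]
  exact J.mul_mem_left _ h

/-- The monomials of `J` are closed under increasing elementary moves. -/
def IsBorelClosed (J : Ideal (MvPolynomial (Fin n) K)) : Prop :=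
  ∀ α β : Fin n →₀ ℕ, α ∈ monomialsIn J → IncreasingMove α β → β ∈ monomialsIn J

theorem IsStronglyStable.isBorelClosed (h : IsStronglyStable J) : IsBorelClosed J :=
  fun α β hα hm => h.2 β α hα (Relation.TransGen.single hm)

theorem exists_lt_of_not_le {γ β : Fin n →₀ ℕ} (h : ¬ γ ≤ β) : ∃ i, β i < γ i := by
  by_contra! H
  exact h H

theorem degree_tsub_single {γ : Fin n →₀ ℕ} {k : Fin n} (hk : 0 < γ k) :
    (γ - Finsupp.single k 1).degree + 1 = γ.degree := by
  have : γ - Finsupp.single k 1 + Finsupp.single k 1 = γ :=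
    tsub_add_cancel_of_le (Finsupp.single_le_iff.2 hk)
  conv_rhs => rw [← this]
  simp

/-- A non-minimal `x^γ` stays in the ideal after division by some `x_i`. If `x_k` is its least
variable, `x^γ / x_k` is `x^γ / x_i` or an increasing move of it, hence also in the ideal. Decompose
that quotient by induction and put `x_k` into the cofactor. -/
theorem IsBorelClosed.exists_isStarDecomposition (hJ : IsBorelClosed J) (d : ℕ) :
    ∀ γ : Fin n →₀ ℕ, γ.degree = d → γ ∈ monomialsIn J →
      ∃ α η, IsStarDecomposition J γ α η := by
  induction d with
  | zero =>
    intro γ hd hγ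
    refine ⟨γ, 0, by simp, ⟨hγ, fun β _ _ => ?_⟩, by simp⟩
    rw [(Finsupp.degree_eq_zero_iff γ).1 hd]
    exact zero_le
  | succ d ih =>
    intro γ hd hγ
    by_cases hB : γ ∈ monomialBasis J
    · exact ⟨γ, 0, by simp, hB, by simp⟩
    obtain ⟨β, hβ, hle, hnle⟩ : ∃ β, β ∈ monomialsIn J ∧ β ≤ γ ∧ ¬ γ ≤ β := by
      by_contra! H
      exact hB ⟨hγ, fun β hβ hle => H β hβ hle⟩
    obtain ⟨i, hi⟩ := exists_lt_of_not_le hnle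
    have hne : γ.support.Nonempty := ⟨i, by rw [Finsupp.mem_support_iff]; omega⟩
    have hk := Finset.min'_mem _ hne
    have hkle : ∀ l ∈ γ.support, γ.support.min' hne ≤ l := fun l hl => Finset.min'_le _ _ hl
    generalize γ.support.min' hne = k at hk hkle
    have hk0 : 0 < γ k := Nat.pos_of_ne_zero (Finsupp.mem_support_iff.1 hk)
    have hsub : ∀ l, 0 < γ l → γ - Finsupp.single l 1 + Finsupp.single l 1 = γ :=
      fun l hl => tsub_add_cancel_of_le (Finsupp.single_le_iff.2 hl)
    have hi' : γ - Finsupp.single i 1 ∈ monomialsIn J := by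
      refine mem_monomialsIn_of_le hβ fun l => ?_
      by_cases hl : i = l
      · subst hl; simp; omega
      · simpa [Finsupp.single_apply, hl] using hle l
    have hk' : γ - Finsupp.single k 1 ∈ monomialsIn J := by
      rcases (hkle i (by rw [Finsupp.mem_support_iff]; omega)).eq_or_lt with rfl | hlt
      · exact hi'
      · exact hJ _ _ hi' ⟨k, i, hlt, by rw [hsub i (by omega), hsub k hk0]⟩
    obtain ⟨α, η, h1, h2, h3⟩ := ih _ (by have := degree_tsub_single hk0; omega) hk'
    have hγ' : γ = α + (η + Finsupp.single k 1) := by rw [← add_assoc, ← h1, hsub k hk0]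
    refine ⟨α, η + Finsupp.single k 1, hγ', h2, fun l hl i hi => ?_⟩
    by_cases hlk : k = l
    · subst hlk
      refine hkle i ?_
      rw [Finsupp.mem_support_iff] at hi ⊢
      rw [hγ']
      simp only [Finsupp.add_apply]
      omega
    · refine h3 l ?_ i hi
      rw [Finsupp.mem_support_iff] at hl ⊢
      simpa [Finsupp.single_apply, hlk] using hl

/-- The order on exponents that compares the exponents of the greatest variables first. -/
def revLex (η : Fin n →₀ ℕ) : Lex (Fin n → ℕ) := toLex fun i => η i.rev

theorem revLex_injective : Function.Injective (revLex : (Fin n →₀ ℕ) → _) := by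
  intro η η' h
  ext i
  have := congrFun (congrArg ofLex h) i.rev
  simpa [revLex] using this

/-- Otherwise `η' = η`, which gives `α = δ`, or `η'` is larger at the greatest variable where they
differ. That variable occurs in `η'`, so `α` has nothing below it; at it and above it, comparing
exponents gives `α ≤ δ`. -/
theorem IsStarDecomposition.revLex_lt {δ η α η' : Fin n →₀ ℕ}
    (h : IsStarDecomposition J (η + δ) α η') (hδ : ¬ α ≤ δ) : revLex η' < revLex η := by
  obtain ⟨h1, -, h3⟩ := h
  have h1' : ∀ x, η x + δ x = α x + η' x := fun x => by simpa using DFunLike.congr_fun h1 x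
  by_contra hlt
  rcases (not_lt.1 hlt).eq_or_lt with heq | hlt
  · have := revLex_injective heq
    subst this
    refine hδ fun x => ?_
    have := h1' x
    omega
  · obtain ⟨i, hi1, hi2⟩ := hlt
    replace hi1 : ∀ x, i.rev < x → η x = η' x := fun x hx => by
      have := hi1 x.rev (Fin.rev_lt_iff.1 hx)
      simpa [revLex] using this
    replace hi2 : η i.rev < η' i.rev := hi2
    refine hδ fun x => ?_
    rcases lt_trichotomy x i.rev with hx | hx | hx
    · have : α x = 0 := by
        by_contra h0
        have := h3 i.rev (by rw [Finsupp.mem_support_iff]; omega) x (by simpa using h0)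
        exact absurd hx (not_lt.2 this)
      omega
    · subst hx; have := h1' i.rev; omega
    · have := h1' x; have := hi1 x hx; omega

/-- By minimality neither of two distinct heads divides the other, so each cofactor would be
strictly smaller than the other. -/
theorem IsStarDecomposition.unique {γ α η α' η' : Fin n →₀ ℕ}
    (h : IsStarDecomposition J γ α η) (h' : IsStarDecomposition J γ α' η') :
    α = α' ∧ η = η' := by
  suffices α = α' by
    subst this
    exact ⟨rfl, add_left_cancel (h.1.symm.trans h'.1)⟩
  by_contra hne
  have key : ∀ {α η α' η' : Fin n →₀ ℕ}, IsStarDecomposition J γ α η →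
      IsStarDecomposition J γ α' η' → α ≠ α' → revLex η' < revLex η := by
    intro α η α' η' h h' hne
    have h0 := h.1
    refine IsStarDecomposition.revLex_lt (J := J) (δ := α) (α := α') ?_ fun hle => hne ?_
    · rwa [add_comm, ← h0]
    · exact le_antisymm (h.2.1.2 h'.2.1.1 hle) hle
  exact lt_asymm (key h h' hne) (key h' h (Ne.symm hne))

end StarDecomposition

/-! ### Termination of reduction, independence of the star products. -/

section Reduction

variable {K : Type u} [Field K] {n : ℕ} {J : Ideal (MvPolynomial (Fin n) K)}
variable {A : Type v} [CommRing A]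

theorem isReducedPoly_iff {p : MvPolynomial (Fin n) A} :
    IsReducedPoly J p ↔ ∀ γ ∈ monomialsIn J, coeff γ p = 0 := by
  refine forall_congr' fun γ => ?_
  rw [mem_support_iff]
  tauto

theorem IsReducedPoly.sub {p q : MvPolynomial (Fin n) A} (hp : IsReducedPoly J p)
    (hq : IsReducedPoly J q) : IsReducedPoly J (p - q) := by
  rw [isReducedPoly_iff] at *
  intro γ hγ
  rw [coeff_sub, hp γ hγ, hq γ hγ, sub_zero]

/-- All the tails of the polynomials `F α` are reduced. -/
def HasReducedTails (F : {α // α ∈ monomialBasis J} → MvPolynomial (Fin n) A) : Prop :=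
  ∀ α, IsReducedPoly J (monomial α.1 1 - F α)

variable {F : {α // α ∈ monomialBasis J} → MvPolynomial (Fin n) A}

/-- The descent behind everything: a tail monomial lies outside `J`, so no head in `B_J` divides it,
and `revLex_lt` applies to its product with `x^η`. -/
theorem coeff_monomial_mul_tail (hF : HasReducedTails F) {α : {α // α ∈ monomialBasis J}}
    {η γ α' η' : Fin n →₀ ℕ} {a : A}
    (hγ : IsStarDecomposition J γ α' η')
    (h : coeff γ (monomial η a * (monomial α.1 1 - F α)) ≠ 0) : revLex η' < revLex η := by
  rw [coeff_monomial_mul'] at h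
  split_ifs at h with hle
  · have hδ := hF α (γ - η) (by rw [mem_support_iff]; exact right_ne_zero_of_mul h)
    have : γ = η + (γ - η) := (add_tsub_cancel_of_le hle).symm
    rw [this] at hγ
    exact hγ.revLex_lt fun hle' => hδ (mem_monomialsIn_of_le hγ.2.1.1 hle')
  · exact absurd rfl h

/-- Induction on the largest cofactor of a monomial of `J` in the support, then on the number of
monomials attaining it. A step at such a monomial deletes it and adds monomials of `J` with smaller
cofactors only. -/
theorem exists_reducesTo (hJ : IsBorelClosed J) (hF : HasReducedTails F)
    (g : MvPolynomial (Fin n) A) : ∃ g', ReducesTo J F g g' ∧ IsReducedPoly J g' := by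
  classical
  have hstar := fun γ hγ => hJ.exists_isStarDecomposition _ γ rfl hγ
  choose! hd tl hst using hstar
  have main : ∀ (w : Lex (Fin n → ℕ)) (k : ℕ) (g : MvPolynomial (Fin n) A),
      (∀ γ ∈ g.support, γ ∈ monomialsIn J → revLex (tl γ) ≤ w) →
      (g.support.filter fun γ => γ ∈ monomialsIn J ∧ revLex (tl γ) = w).card = k →
      ∃ g', ReducesTo J F g g' ∧ IsReducedPoly J g' := by
    intro w
    induction w using WellFoundedLT.induction with | _ w ihw
    intro k
    induction k using Nat.strong_induction_on with | _ k ihk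
    intro g hw hk
    by_cases hred : IsReducedPoly J g
    · exact ⟨g, Relation.ReflTransGen.refl, hred⟩
    rcases (g.support.filter fun γ => γ ∈ monomialsIn J ∧
      revLex (tl γ) = w).eq_empty_or_nonempty with he | ⟨γ, hγ⟩
    -- Here `w` is only an upper bound that no cofactor attains; the true maximum is smaller.
    · have hne : (g.support.filter fun γ => γ ∈ monomialsIn J).Nonempty := by
        by_contra hne
        rw [Finset.not_nonempty_iff_eq_empty, Finset.filter_eq_empty_iff] at hne
        exact hred fun γ hγ => hne hγ
      obtain ⟨γ, hγ, hmax⟩ := Finset.exists_max_image _ (fun γ => revLex (tl γ)) hne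
      rw [Finset.mem_filter] at hγ
      have hlt : revLex (tl γ) < w := by
        refine lt_of_le_of_ne (hw γ hγ.1 hγ.2) fun heq => ?_
        have : γ ∈ (∅ : Finset (Fin n →₀ ℕ)) := by
          rw [← he, Finset.mem_filter]
          exact ⟨hγ.1, hγ.2, heq⟩
        simp at this
      exact ihw _ hlt _ g (fun γ' h1 h2 => hmax γ' (Finset.mem_filter.2 ⟨h1, h2⟩)) rfl
    · obtain ⟨hγs, hγJ, hγw⟩ := Finset.mem_filter.1 hγ
      have hs := hst γ hγJ
      set α : {α // α ∈ monomialBasis J} := ⟨hd γ, hs.2.1⟩ with hα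
      set g₁ := g - monomial (tl γ) (coeff γ g) * F α with hg₁
      have hg₁' : g₁ = (g - monomial γ (coeff γ g)) +
          monomial (tl γ) (coeff γ g) * (monomial α.1 1 - F α) := by
        have : monomial γ (coeff γ g) = monomial (tl γ) (coeff γ g) * monomial α.1 1 := by
          rw [monomial_mul, mul_one]
          congr 1
          rw [add_comm]
          exact congrArg (fun x => monomial x) hs.1
        rw [this, hg₁]
        ring
      have hsupp : ∀ γ' ∈ g₁.support, γ' ∈ monomialsIn J →
          revLex (tl γ') < w ∨ (γ' ∈ g.support ∧ γ' ≠ γ) := by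
        intro γ' h1 h2
        by_contra H
        rw [not_or, not_and, not_not] at H
        have h3 : coeff γ' (monomial (tl γ) (coeff γ g) * (monomial α.1 1 - F α)) = 0 := by
          by_contra h0
          have := coeff_monomial_mul_tail hF (hst γ' h2) h0
          rw [hγw] at this
          exact H.1 this
        rw [mem_support_iff, hg₁', coeff_add, h3, add_zero, coeff_sub, coeff_monomial] at h1
        split_ifs at h1 with heq
        · subst heq; simp at h1
        · rw [sub_zero] at h1
          exact heq (H.2 (mem_support_iff.2 h1)).symm
      have hcard : (g₁.support.filter fun γ => γ ∈ monomialsIn J ∧ revLex (tl γ) = w).card < k := by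
        rw [← hk]
        refine Finset.card_lt_card ((Finset.ssubset_iff_of_subset fun γ' h => ?_).2
          ⟨γ, hγ, fun h => ?_⟩)
        · obtain ⟨h1, h2, h3⟩ := Finset.mem_filter.1 h
          rcases hsupp γ' h1 h2 with h4 | h4
          · exact absurd h3 h4.ne
          · exact Finset.mem_filter.2 ⟨h4.1, h2, h3⟩
        · obtain ⟨h1, h2, h3⟩ := Finset.mem_filter.1 h
          rcases hsupp γ h1 h2 with h4 | h4
          · exact h4.ne h3
          · exact h4.2 rfl
      obtain ⟨g', hg', hr⟩ := ihk _ hcard g₁ (fun γ' h1 h2 => by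
        rcases hsupp γ' h1 h2 with h3 | h3
        · exact h3.le
        · exact hw γ' h3.1 h2) rfl
      exact ⟨g', Relation.ReflTransGen.head ⟨γ, α, tl γ, hγs, hs, hg₁⟩ hg', hr⟩
  by_cases hred : IsReducedPoly J g
  · exact ⟨g, Relation.ReflTransGen.refl, hred⟩
  have hne : (g.support.filter fun γ => γ ∈ monomialsIn J).Nonempty := by
    by_contra hne
    rw [Finset.not_nonempty_iff_eq_empty, Finset.filter_eq_empty_iff] at hne
    exact hred fun γ hγ => hne hγ
  obtain ⟨γ, hγ, hmax⟩ := Finset.exists_max_image _ (fun γ => revLex (tl γ)) hne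
  exact main _ _ g (fun γ' h1 h2 => hmax γ' (Finset.mem_filter.2 ⟨h1, h2⟩)) rfl

/-- The pairs `(α, η)` with `x^α x^η = x^α *_J x^η`. -/
abbrev StarIdx (J : Ideal (MvPolynomial (Fin n) K)) : Type :=
  {p : {α // α ∈ monomialBasis J} × (Fin n →₀ ℕ) // IsStarDecomposition J (p.1.1 + p.2) p.1.1 p.2}

/-- The products `x^η F α` with `x^α x^η = x^α *_J x^η`. -/
noncomputable def starPoly (F : {α // α ∈ monomialBasis J} → MvPolynomial (Fin n) A)
    (p : StarIdx J) : MvPolynomial (Fin n) A :=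
  monomial p.1.2 1 * F p.1.1

/-- The module generated by the products `x^η F α` with `x^α x^η = x^α *_J x^η`. -/
noncomputable def starSpan (F : {α // α ∈ monomialBasis J} → MvPolynomial (Fin n) A) :
    Submodule A (MvPolynomial (Fin n) A) :=
  Submodule.span A (Set.range (starPoly F))

theorem starSpan_le : starSpan F ≤ (Ideal.span (Set.range F)).restrictScalars A := by
  refine Submodule.span_le.2 ?_
  rintro _ ⟨p, rfl⟩
  exact Ideal.mul_mem_left _ _ (Ideal.subset_span ⟨_, rfl⟩)

theorem ReducesTo.sub_mem_starSpan {g g' : MvPolynomial (Fin n) A} (h : ReducesTo J F g g') :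
    g - g' ∈ starSpan F := by
  induction h with
  | refl => simp
  | tail _ hstep ih =>
    obtain ⟨γ, α, η, -, hst, rfl⟩ := hstep
    rw [← sub_add]
    refine add_mem ih ?_
    have : monomial η (1 : A) * F α ∈ starSpan F :=
      Submodule.subset_span ⟨⟨(α, η), hst.1 ▸ hst⟩, rfl⟩
    have h2 := fun a => (starSpan F).smul_mem a this
    simp only [← smul_mul_assoc, smul_monomial, smul_eq_mul, mul_one] at h2
    exact h2 _

theorem ReducesTo.sub_mem {g g' : MvPolynomial (Fin n) A} (h : ReducesTo J F g g') :
    g - g' ∈ Ideal.span (Set.range F) :=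
  starSpan_le h.sub_mem_starSpan

theorem exists_isReducedPoly (hJ : IsBorelClosed J) (hF : HasReducedTails F)
    (g : MvPolynomial (Fin n) A) :
    ∃ r, IsReducedPoly J r ∧ g - r ∈ Ideal.span (Set.range F) := by
  obtain ⟨r, hr, hred⟩ := exists_reducesTo hJ hF g
  exact ⟨r, hred, hr.sub_mem⟩

/-- Look at the head of a star product whose cofactor is maximal in the combination. Other heads
differ from it by uniqueness, and a tail could reach it only from a larger cofactor. So its
coefficient survives, though the monomial is in `J`. -/
theorem eq_zero_of_mem_starSpan (hF : HasReducedTails F) {p : MvPolynomial (Fin n) A}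
    (hp : p ∈ starSpan F) (hr : IsReducedPoly J p) : p = 0 := by
  obtain ⟨c, rfl⟩ := Finsupp.mem_span_range_iff_exists_finsupp.1 hp
  rcases c.support.eq_empty_or_nonempty with he | hne
  · rw [Finsupp.support_eq_empty.1 he]; simp
  exfalso
  obtain ⟨q, hq, hmax⟩ := Finset.exists_max_image _ (fun q : StarIdx J => revLex q.1.2) hne
  have hco := isReducedPoly_iff.1 hr (q.1.1.1 + q.1.2)
    (mem_monomialsIn_of_le q.1.1.2.1 le_self_add)
  rw [Finsupp.sum, coeff_sum, Finset.sum_eq_single q] at hco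
  · rw [coeff_smul, smul_eq_mul] at hco
    have h1 : coeff (q.1.1.1 + q.1.2) (starPoly F q) = 1 := by
      have h2 : starPoly F q = monomial (q.1.1.1 + q.1.2) 1 -
          monomial q.1.2 1 * (monomial q.1.1.1 1 - F q.1.1) := by
        rw [mul_sub, monomial_mul, add_comm q.1.2, one_mul, starPoly]
        ring
      rw [h2, coeff_sub, coeff_monomial, if_pos rfl, sub_eq_self]
      by_contra h0
      exact lt_irrefl _ (coeff_monomial_mul_tail hF q.2 h0)
    rw [h1, mul_one] at hco
    exact (Finsupp.mem_support_iff.1 hq) hco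
  · intro q' hq' hne'
    have h2 : starPoly F q' = monomial (q'.1.1.1 + q'.1.2) 1 -
        monomial q'.1.2 1 * (monomial q'.1.1.1 1 - F q'.1.1) := by
      rw [mul_sub, monomial_mul, add_comm q'.1.2, one_mul, starPoly]
      ring
    rw [coeff_smul, h2, coeff_sub, coeff_monomial, if_neg, zero_sub]
    · have : coeff (q.1.1.1 + q.1.2)
          (monomial q'.1.2 1 * (monomial q'.1.1.1 1 - F q'.1.1)) = 0 := by
        by_contra h0
        exact absurd (coeff_monomial_mul_tail hF q.2 h0) (not_lt.2 (hmax q' hq'))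
      rw [this, neg_zero, smul_zero]
    · intro heq
      have h3 := q'.2
      rw [heq] at h3
      obtain ⟨e1, e2⟩ := h3.unique q.2
      exact hne' (Subtype.ext (Prod.ext (Subtype.ext e1) e2))
  · intro h
    exact absurd hq h

end Reduction

/-! ### Specialization of the generic marked set. -/

section Generic

variable {K : Type u} [Field K] {n : ℕ} {J : Ideal (MvPolynomial (Fin n) K)}
variable {T : (Fin n →₀ ℕ) → Finset (Fin n →₀ ℕ)}
variable {A : Type v} [CommRing A]

theorem coeff_markedPoly {B : Set (Fin n →₀ ℕ)} (c : CoeffIdx B T → A) (α : {α // α ∈ B})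
    (γ : Fin n →₀ ℕ) :
    coeff γ (markedPoly c α) =
      coeff γ (monomial α.1 (1 : A)) - if h : γ ∈ T α.1 then c ⟨α, ⟨γ, h⟩⟩ else 0 := by
  classical
  rw [markedPoly, coeff_sub, coeff_sum]
  congr 1
  simp only [coeff_monomial]
  split_ifs with h
  · rw [Finset.sum_eq_single ⟨γ, h⟩]
    · simp
    · intro b _ hb
      rw [if_neg]
      rintro rfl
      exact hb rfl
    · simp
  · refine Finset.sum_eq_zero fun b _ => if_neg ?_
    rintro rfl
    exact h b.2

theorem markedPoly_coeff {B : Set (Fin n →₀ ℕ)} (r : {α // α ∈ B} → MvPolynomial (Fin n) A)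
    (hr : ∀ α, ∀ γ, γ ∉ T α.1 → coeff γ (r α) = 0) (α : {α // α ∈ B}) :
    markedPoly (fun p : CoeffIdx B T => coeff p.2.1 (r p.1)) α = monomial α.1 1 - r α := by
  ext γ
  rw [coeff_markedPoly, coeff_sub]
  congr 1
  split_ifs with h
  · rfl
  · exact (hr α γ h).symm

theorem markedPoly_injective {B : Set (Fin n →₀ ℕ)} {c c' : CoeffIdx B T → A}
    (h : ∀ α, markedPoly c α = markedPoly c' α) : c = c' := by
  funext ⟨α, γ, hγ⟩
  have := congrArg (coeff γ) (h α)
  rw [coeff_markedPoly, coeff_markedPoly, dif_pos hγ, dif_pos hγ] at this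
  exact sub_right_injective this

theorem map_markedPoly {A' : Type*} [CommRing A'] (φ : A →+* A') {B : Set (Fin n →₀ ℕ)}
    (c : CoeffIdx B T → A) (α : {α // α ∈ B}) :
    MvPolynomial.map φ (markedPoly c α) = markedPoly (φ ∘ c) α := by
  simp [markedPoly, map_monomial]

theorem hasReducedTails_markedPoly (hT : ∀ α, ∀ γ ∈ T α, γ ∉ monomialsIn J)
    (c : CoeffIdx (monomialBasis J) T → A) : HasReducedTails (markedPoly c) := by
  intro α
  rw [isReducedPoly_iff]
  intro γ hγ
  rw [coeff_sub, coeff_markedPoly, dif_neg fun h => hT _ γ h hγ]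
  simp

theorem IsReducedPoly.map {A' : Type*} [CommRing A'] (φ : A →+* A') {p : MvPolynomial (Fin n) A}
    (hp : IsReducedPoly J p) : IsReducedPoly J (MvPolynomial.map φ p) := by
  rw [isReducedPoly_iff] at *
  intro γ hγ
  rw [coeff_map, hp γ hγ, map_zero]

variable [Algebra K A]

theorem map_markedPoly_X {B : Set (Fin n →₀ ℕ)} (c : CoeffIdx B T → A) (α : {α // α ∈ B}) :
    MvPolynomial.map (aeval c : MvPolynomial (CoeffIdx B T) K →ₐ[K] A).toRingHom
      (markedPoly (X : CoeffIdx B T → MvPolynomial (CoeffIdx B T) K) α) = markedPoly c α := by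
  rw [map_markedPoly]
  congr 1
  funext p
  simp

theorem map_mem_markedIdeal {B : Set (Fin n →₀ ℕ)} (c : CoeffIdx B T → A)
    {p : MvPolynomial (Fin n) (MvPolynomial (CoeffIdx B T) K)}
    (hp : p ∈ markedIdeal (X : CoeffIdx B T → MvPolynomial (CoeffIdx B T) K)) :
    MvPolynomial.map (aeval c : MvPolynomial (CoeffIdx B T) K →ₐ[K] A).toRingHom p ∈
      markedIdeal c := by
  have := Ideal.mem_map_of_mem (MvPolynomial.map
    (aeval c : MvPolynomial (CoeffIdx B T) K →ₐ[K] A).toRingHom) hp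
  rw [markedIdeal, Ideal.map_span] at this
  refine Ideal.span_mono ?_ this
  rintro _ ⟨_, ⟨α, rfl⟩, rfl⟩
  exact ⟨α, (map_markedPoly_X c α).symm⟩

/-- Reduce each generic product `x^η f_α`. The remainder is a reduced element of the generic ideal,
so it dies under specialization, leaving a combination of star products. Membership in the span
specializes even though single reduction steps need not. -/
theorem markedIdeal_le_starSpan (hJ : IsBorelClosed J) (hT : ∀ α, ∀ γ ∈ T α, γ ∉ monomialsIn J)
    (c : CoeffIdx (monomialBasis J) T → A)
    (hc : ∀ p ∈ markedIdeal (X : CoeffIdx (monomialBasis J) T → MvPolynomial _ K),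
      IsReducedPoly J p → ∀ γ, aeval c (coeff γ p) = 0) :
    (markedIdeal c).restrictScalars A ≤ starSpan (markedPoly c) := by
  set φ := (aeval c : MvPolynomial (CoeffIdx (monomialBasis J) T) K →ₐ[K] A).toRingHom with hφ
  have hspan : ∀ p ∈ starSpan
      (markedPoly (X : CoeffIdx (monomialBasis J) T → MvPolynomial _ K)),
      MvPolynomial.map φ p ∈ starSpan (markedPoly c) := by
    intro p hp
    induction hp using Submodule.span_induction with
    | mem x hx =>
      obtain ⟨q, rfl⟩ := hx
      refine Submodule.subset_span ⟨q, ?_⟩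
      rw [starPoly, starPoly, map_mul, map_monomial, map_one φ, map_markedPoly_X]
    | zero => simp
    | add x y _ _ hx hy => rw [map_add]; exact add_mem hx hy
    | smul a x _ hx =>
      rw [smul_eq_C_mul, map_mul, map_C, ← smul_eq_C_mul]
      exact Submodule.smul_mem _ _ hx
  have hmul : ∀ (η : Fin n →₀ ℕ) (α : {α // α ∈ monomialBasis J}),
      monomial η 1 * markedPoly c α ∈ starSpan (markedPoly c) := by
    intro η α
    set P := monomial η 1 *
      markedPoly (X : CoeffIdx (monomialBasis J) T → MvPolynomial _ K) α with hP
    obtain ⟨r, hr, hred⟩ := exists_reducesTo hJ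
      (hasReducedTails_markedPoly hT (X : CoeffIdx (monomialBasis J) T → MvPolynomial _ K)) P
    have hPm : P ∈ markedIdeal (X : CoeffIdx (monomialBasis J) T → MvPolynomial _ K) :=
      Ideal.mul_mem_left _ _ (Ideal.subset_span ⟨α, rfl⟩)
    have hrm : r ∈ markedIdeal (X : CoeffIdx (monomialBasis J) T → MvPolynomial _ K) := by
      have := sub_mem hPm hr.sub_mem
      rwa [sub_sub_cancel] at this
    have h0 : MvPolynomial.map φ r = 0 := by
      ext γ
      rw [coeff_map, coeff_zero]
      exact hc r hrm hred γ
    have h1 := hspan _ hr.sub_mem_starSpan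
    rwa [map_sub, h0, sub_zero, hP, map_mul, map_monomial, map_one φ, map_markedPoly_X] at h1
  intro p hp
  rw [Submodule.restrictScalars_mem] at hp
  induction hp using Submodule.span_induction with
  | mem x hx =>
    obtain ⟨α, rfl⟩ := hx
    simpa using hmul 0 α
  | zero => simp
  | add x y _ _ hx hy => exact add_mem hx hy
  | smul a x _ hx =>
    have hmon : ∀ (η : Fin n →₀ ℕ) (b : A), ∀ x ∈ starSpan (markedPoly c),
        monomial η b * x ∈ starSpan (markedPoly c) := by
      intro η b x hx
      induction hx using Submodule.span_induction with
      | mem x hx =>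
        obtain ⟨q, rfl⟩ := hx
        rw [starPoly, ← mul_assoc, monomial_mul, mul_one, show
          monomial (η + q.1.2) b = b • monomial (η + q.1.2) (1 : A) by
            rw [smul_monomial, smul_eq_mul, mul_one], smul_mul_assoc]
        exact Submodule.smul_mem _ _ (hmul _ _)
      | zero => simp
      | add x y _ _ hx hy => rw [mul_add]; exact add_mem hx hy
      | smul a x _ hx => rw [mul_smul_comm]; exact Submodule.smul_mem _ _ hx
    rw [smul_eq_mul, a.as_sum, Finset.sum_mul]
    exact Submodule.sum_mem _ fun η _ => hmon _ _ _ hx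

/-- The coefficients of the reduced polynomials in the ideal of the generic marked set vanish at `c`
if and only if the ideal of the specialized marked set contains no nonzero reduced polynomial. -/
theorem forall_aeval_coeff_eq_zero_iff (hJ : IsBorelClosed J)
    (hT : ∀ α, ∀ γ ∈ T α, γ ∉ monomialsIn J) (c : CoeffIdx (monomialBasis J) T → A) :
    (∀ p ∈ markedIdeal (X : CoeffIdx (monomialBasis J) T → MvPolynomial _ K),
      IsReducedPoly J p → ∀ γ, aeval c (coeff γ p) = 0) ↔
    ∀ p ∈ markedIdeal c, IsReducedPoly J p → p = 0 := by
  constructor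
  · intro hc p hp hr
    exact eq_zero_of_mem_starSpan (hasReducedTails_markedPoly hT c)
      (markedIdeal_le_starSpan hJ hT c hc hp) hr
  · intro h p hp hr γ
    have := congrArg (coeff γ) (h _ (map_mem_markedIdeal c hp) (hr.map _))
    rwa [coeff_map, coeff_zero] at this

end Generic

/-! ### Homogenization, dehomogenization and truncation. -/

section Homogeneous

variable {A : Type v} [CommRing A] {n : ℕ}

theorem degree_cons (a : ℕ) (γ : Fin n →₀ ℕ) : (Finsupp.cons a γ).degree = a + γ.degree := by
  simp [Finsupp.degree_eq_sum, Fin.sum_univ_succ]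

theorem degree_eq_zero_add_tail (δ : Fin (n + 1) →₀ ℕ) :
    δ.degree = δ 0 + (Finsupp.tail δ).degree := by
  conv_lhs => rw [← Finsupp.cons_tail δ]
  exact degree_cons _ _

theorem coeff_eq_zero_of_mem_span {m : ℕ} {S : Set (MvPolynomial (Fin n) A)}
    (hS : ∀ F ∈ S, ∀ δ : Fin n →₀ ℕ, δ.degree < m → coeff δ F = 0) {F : MvPolynomial (Fin n) A}
    (hF : F ∈ Ideal.span S) {δ : Fin n →₀ ℕ} (hδ : δ.degree < m) : coeff δ F = 0 := by
  induction hF using Submodule.span_induction generalizing δ with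
  | mem x hx => exact hS x hx δ hδ
  | zero => simp
  | add x y _ _ hx hy => rw [coeff_add, hx hδ, hy hδ, add_zero]
  | smul a x _ hx =>
    classical
    rw [smul_eq_mul, coeff_mul]
    refine Finset.sum_eq_zero fun p hp => ?_
    have : p.1.degree + p.2.degree = δ.degree := by
      rw [← Finset.HasAntidiagonal.mem_antidiagonal.1 hp]; simp
    rw [hx (by omega), mul_zero]

/-- The ideal `I` contains the homogeneous components of its elements. -/
def ContainsComponents (I : Ideal (MvPolynomial (Fin n) A)) : Prop :=
  ∀ F ∈ I, ∀ t, homogeneousComponent t F ∈ I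

theorem containsComponents_span {S : Set (MvPolynomial (Fin n) A)}
    (hS : ∀ F ∈ S, ∃ t, F.IsHomogeneous t) : ContainsComponents (Ideal.span S) := by
  let := MvPolynomial.gradedAlgebra (σ := Fin n) (R := A)
  intro F hF t
  exact homogeneousComponent_mem_of_mem (Ideal.homogeneous_span _ S hS) hF t

theorem dehomogenization_monomial (δ : Fin (n + 1) →₀ ℕ) (a : A) :
    dehomogenization A n (monomial δ a) = monomial (Finsupp.tail δ) a := by
  rw [dehomogenization, aeval_monomial, monomial_eq, Finsupp.prod_fintype _ _ (by simp),
    Finsupp.prod_fintype _ _ (by simp), Fin.prod_univ_succ]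
  simp [Finsupp.tail_apply]

/-- In a fixed degree `t`, setting `x₀ = 1` merely relabels coefficients: the exponent of `x₀` is
recovered as `t - |γ|`. -/
theorem coeff_dehomogenization {F : MvPolynomial (Fin (n + 1)) A} {t : ℕ}
    (hF : F.IsHomogeneous t) (γ : Fin n →₀ ℕ) :
    coeff γ (dehomogenization A n F) =
      if γ.degree ≤ t then coeff (Finsupp.cons (t - γ.degree) γ) F else 0 := by
  classical
  have key : ∀ δ ∈ F.support, Finsupp.tail δ = γ →
      γ.degree ≤ t ∧ δ = Finsupp.cons (t - γ.degree) γ := by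
    rintro δ hδ rfl
    have h1 : δ.degree = t := by
      by_contra h
      exact (mem_support_iff.1 hδ) (hF.coeff_eq_zero h)
    rw [degree_eq_zero_add_tail] at h1
    refine ⟨by omega, ?_⟩
    conv_lhs => rw [← Finsupp.cons_tail δ]
    congr 1
    omega
  conv_lhs => rw [F.as_sum, map_sum, coeff_sum]
  simp only [dehomogenization_monomial, coeff_monomial]
  split_ifs with h
  · rw [Finset.sum_eq_single (Finsupp.cons (t - γ.degree) γ)]
    · simp
    · intro δ hδ hne
      exact if_neg fun h => hne (key δ hδ h).2
    · intro h
      rw [notMem_support_iff.1 h, ite_self]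
  · exact Finset.sum_eq_zero fun δ hδ => if_neg fun h' => h (key δ hδ h').1

theorem coeff_tail_dehomogenization {F : MvPolynomial (Fin (n + 1)) A} {t : ℕ}
    (hF : F.IsHomogeneous t) {δ : Fin (n + 1) →₀ ℕ} (hδ : δ.degree = t) :
    coeff (Finsupp.tail δ) (dehomogenization A n F) = coeff δ F := by
  rw [degree_eq_zero_add_tail] at hδ
  rw [coeff_dehomogenization hF, if_pos (by omega)]
  have : t - (Finsupp.tail δ).degree = δ 0 := by omega
  rw [this, Finsupp.cons_tail]

theorem eq_of_dehomogenization_eq {F G : MvPolynomial (Fin (n + 1)) A} {t : ℕ}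
    (hF : F.IsHomogeneous t) (hG : G.IsHomogeneous t)
    (h : dehomogenization A n F = dehomogenization A n G) : F = G := by
  ext δ
  by_cases hδ : δ.degree = t
  · rw [← coeff_tail_dehomogenization hF hδ, h, coeff_tail_dehomogenization hG hδ]
  · rw [hF.coeff_eq_zero hδ, hG.coeff_eq_zero hδ]

theorem degree_le_totalDegree {p : MvPolynomial (Fin n) A} {γ : Fin n →₀ ℕ} (h : γ ∈ p.support) :
    γ.degree ≤ p.totalDegree := by
  have := le_totalDegree h
  rwa [Finsupp.sum_fintype γ (fun _ a => a) (fun _ => rfl), ← Finsupp.degree_eq_sum] at this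

theorem totalDegree_le_of_coeff {p : MvPolynomial (Fin n) A} {t : ℕ}
    (h : ∀ γ : Fin n →₀ ℕ, t < γ.degree → coeff γ p = 0) : p.totalDegree ≤ t := by
  refine Finset.sup_le fun γ hγ => ?_
  rw [Finsupp.sum_fintype γ (fun _ a => a) (fun _ => rfl), ← Finsupp.degree_eq_sum]
  by_contra hlt
  exact (mem_support_iff.1 hγ) (h γ (not_le.1 hlt))

theorem totalDegree_dehomogenization_le {F : MvPolynomial (Fin (n + 1)) A} {t : ℕ}
    (hF : F.IsHomogeneous t) : (dehomogenization A n F).totalDegree ≤ t := by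
  refine totalDegree_le_of_coeff fun γ hγ => ?_
  rw [coeff_dehomogenization hF, if_neg (not_le.2 hγ)]

/-- The homogeneous polynomial of degree `t` with dehomogenization `p`, where `deg p ≤ t`. -/
noncomputable def homogenizationAt (t : ℕ) (p : MvPolynomial (Fin n) A) :
    MvPolynomial (Fin (n + 1)) A :=
  ∑ γ ∈ p.support, monomial (Finsupp.cons (t - γ.degree) γ) (coeff γ p)

theorem dehomogenization_homogenizationAt (t : ℕ) (p : MvPolynomial (Fin n) A) :
    dehomogenization A n (homogenizationAt t p) = p := by
  rw [homogenizationAt, map_sum]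
  simp only [dehomogenization_monomial, Finsupp.tail_cons]
  exact (p.as_sum).symm

theorem coeff_eq_zero_of_totalDegree_lt_degree {p : MvPolynomial (Fin n) A} {γ : Fin n →₀ ℕ}
    (h : p.totalDegree < γ.degree) : coeff γ p = 0 := by
  by_contra h0
  exact absurd (degree_le_totalDegree (mem_support_iff.2 h0)) (not_le.2 h)

theorem isHomogeneous_homogenizationAt {t : ℕ} {p : MvPolynomial (Fin n) A}
    (h : p.totalDegree ≤ t) : (homogenizationAt t p).IsHomogeneous t := by
  refine IsHomogeneous.sum _ _ _ fun γ hγ => isHomogeneous_monomial _ ?_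
  rw [degree_cons]
  have := degree_le_totalDegree hγ
  omega

theorem dehomogenization_homogenization (p : MvPolynomial (Fin n) A) :
    dehomogenization A n (homogenization p) = p :=
  dehomogenization_homogenizationAt _ _

theorem dehomogenization_surjective : Function.Surjective (dehomogenization A n) :=
  fun p => ⟨_, dehomogenization_homogenization p⟩

theorem mem_dehomogenizationIdeal {I : Ideal (MvPolynomial (Fin (n + 1)) A)}
    {F : MvPolynomial (Fin (n + 1)) A} (hF : F ∈ I) :
    dehomogenization A n F ∈ dehomogenizationIdeal I :=
  Ideal.mem_map_of_mem _ hF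

theorem dehomogenization_X_pow_mul (k : ℕ) (F : MvPolynomial (Fin (n + 1)) A) :
    dehomogenization A n (X 0 ^ k * F) = dehomogenization A n F := by
  rw [map_mul, map_pow]
  simp [dehomogenization]

/-- Lift to any `F` in `I`, then multiply its components by powers of `x₀` to bring them to one
degree; this does not change the dehomogenization. -/
theorem exists_isHomogeneous_of_mem_dehomogenizationIdeal
    {I : Ideal (MvPolynomial (Fin (n + 1)) A)} (hI : ContainsComponents I)
    {q : MvPolynomial (Fin n) A} (hq : q ∈ dehomogenizationIdeal I) :
    ∃ F ∈ I, ∃ t, F.IsHomogeneous t ∧ dehomogenization A n F = q := by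
  obtain ⟨F, hF, rfl⟩ := (Ideal.mem_map_iff_of_surjective _ dehomogenization_surjective).1 hq
  refine ⟨∑ s ∈ Finset.range (F.totalDegree + 1),
    X 0 ^ (F.totalDegree - s) * homogeneousComponent s F, ?_, F.totalDegree, ?_, ?_⟩
  · exact Ideal.sum_mem _ fun s _ => Ideal.mul_mem_left _ _ (hI F hF s)
  · refine IsHomogeneous.sum _ _ _ fun s hs => ?_
    have := ((isHomogeneous_X_pow (R := A) (0 : Fin (n + 1)) (F.totalDegree - s)).mul
      (homogeneousComponent_isHomogeneous s F))
    rwa [Nat.sub_add_cancel (by have := Finset.mem_range.1 hs; omega)] at this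
  · rw [map_sum]
    simp only [dehomogenization_X_pow_mul]
    rw [← map_sum, sum_homogeneousComponent]

theorem dehomogenizationIdeal_homogenizationIdeal (I : Ideal (MvPolynomial (Fin n) A)) :
    dehomogenizationIdeal (homogenizationIdeal I) = I := by
  apply le_antisymm
  · rw [dehomogenizationIdeal, homogenizationIdeal, Ideal.map_span, Ideal.span_le]
    rintro _ ⟨_, ⟨f, hf, rfl⟩, rfl⟩
    change dehomogenization A n (homogenization f) ∈ I
    rwa [dehomogenization_homogenization]
  · intro f hf
    rw [← dehomogenization_homogenization f]
    exact mem_dehomogenizationIdeal (Ideal.subset_span ⟨f, hf, rfl⟩)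

theorem mem_homogenizationIdeal {I : Ideal (MvPolynomial (Fin n) A)}
    {F : MvPolynomial (Fin (n + 1)) A} {t : ℕ} (hF : F.IsHomogeneous t)
    (h : dehomogenization A n F ∈ I) : F ∈ homogenizationIdeal I := by
  set f := dehomogenization A n F with hf
  have hd : f.totalDegree ≤ t := totalDegree_dehomogenization_le hF
  have : F = X 0 ^ (t - f.totalDegree) * homogenization f := by
    refine eq_of_dehomogenization_eq hF ?_ ?_
    · have := (isHomogeneous_X_pow (R := A) (0 : Fin (n + 1)) (t - f.totalDegree)).mul
        (isHomogeneous_homogenizationAt le_rfl : (homogenizationAt f.totalDegree f).IsHomogeneous _)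
      rwa [Nat.sub_add_cancel hd] at this
    · rw [dehomogenization_X_pow_mul, dehomogenization_homogenization]
  rw [this]
  exact Ideal.mul_mem_left _ _ (Ideal.subset_span ⟨f, h, rfl⟩)

theorem mem_truncation_homogenizationIdeal {I : Ideal (MvPolynomial (Fin n) A)}
    {F : MvPolynomial (Fin (n + 1)) A} {t m : ℕ} (hF : F.IsHomogeneous t) (hm : m ≤ t)
    (h : dehomogenization A n F ∈ I) : F ∈ truncation (homogenizationIdeal I) m :=
  Ideal.subset_span ⟨mem_homogenizationIdeal hF h, t, hm, hF⟩

theorem truncation_le {I : Ideal (MvPolynomial (Fin n) A)} {m : ℕ} : truncation I m ≤ I :=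
  Ideal.span_le.2 fun _ h => h.1

theorem coeff_eq_zero_of_mem_truncation {I : Ideal (MvPolynomial (Fin n) A)} {m : ℕ}
    {F : MvPolynomial (Fin n) A} (hF : F ∈ truncation I m) {δ : Fin n →₀ ℕ}
    (hδ : δ.degree < m) : coeff δ F = 0 := by
  refine coeff_eq_zero_of_mem_span ?_ hF hδ
  rintro F ⟨-, t, ht, hF⟩ δ hδ
  exact hF.coeff_eq_zero (by omega)

end Homogeneous

/-! ### Monomials and minimal generators of the truncated homogenization. -/

section Truncation

variable {K : Type u} [Field K] {n m : ℕ} {j : Ideal (MvPolynomial (Fin n) K)}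
  {J : Ideal (MvPolynomial (Fin (n + 1)) K)}

/-- The monomials of `J` are those of degree at least `m` that dehomogenize to monomials of `j`. -/
def IsTruncatedHomogenization (j : Ideal (MvPolynomial (Fin n) K)) (m : ℕ)
    (J : Ideal (MvPolynomial (Fin (n + 1)) K)) : Prop :=
  ∀ δ : Fin (n + 1) →₀ ℕ, δ ∈ monomialsIn J ↔ Finsupp.tail δ ∈ monomialsIn j ∧ m ≤ δ.degree

theorem isTruncatedHomogenization :
    IsTruncatedHomogenization j m (truncation (homogenizationIdeal j) m) := by
  intro δ
  constructor
  · intro h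
    constructor
    · have := mem_dehomogenizationIdeal (truncation_le h)
      rwa [dehomogenizationIdeal_homogenizationIdeal, dehomogenization_monomial] at this
    · by_contra hlt
      have := coeff_eq_zero_of_mem_truncation h (not_le.1 hlt)
      simp at this
  · rintro ⟨h1, h2⟩
    refine mem_truncation_homogenizationIdeal (isHomogeneous_monomial _ rfl) h2 ?_
    rwa [dehomogenization_monomial]

theorem IsTruncatedHomogenization.isBorelClosed (h : IsTruncatedHomogenization j m J)
    (hj : IsBorelClosed j) : IsBorelClosed J := by
  intro α β hα ⟨i, k, hik, heq⟩
  obtain ⟨h1, h2⟩ := (h α).1 hα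
  have hdeg : α.degree = β.degree := by
    have := congrArg Finsupp.degree heq
    simpa using this
  refine (h β).2 ⟨?_, hdeg ▸ h2⟩
  obtain ⟨k, rfl⟩ := Fin.exists_succ_eq.2 (Fin.ne_zero_of_lt hik)
  have heq' : ∀ x, α x + Finsupp.single k.succ 1 x = β x + Finsupp.single i 1 x :=
    fun x => by simpa using DFunLike.congr_fun heq x
  induction i using Fin.cases with
  | zero =>
    -- Replacing `x₀` by `x_k` multiplies the dehomogenized monomial by `x_k`.
    refine mem_monomialsIn_of_le h1 fun x => ?_
    have := heq' x.succ
    rw [Finsupp.single_eq_of_ne (a := (0 : Fin (n + 1))) (Fin.succ_ne_zero x)] at this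
    simp only [Finsupp.tail_apply]
    omega
  | succ i =>
    refine hj _ _ h1 ⟨i, k, Fin.succ_lt_succ_iff.1 hik, ?_⟩
    ext x
    have := heq' x.succ
    simpa [Finsupp.single_apply, Finsupp.tail_apply] using this

theorem tail_le_tail {δ ε : Fin (n + 1) →₀ ℕ} (h : δ ≤ ε) : Finsupp.tail δ ≤ Finsupp.tail ε :=
  fun i => h i.succ

theorem eq_of_le_of_degree_le {δ ε : Fin n →₀ ℕ} (h : δ ≤ ε) (hd : ε.degree ≤ δ.degree) :
    δ = ε := by
  have h1 : ε = δ + (ε - δ) := (add_tsub_cancel_of_le h).symm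
  have h2 := congrArg Finsupp.degree h1
  rw [map_add] at h2
  have h3 : ε - δ = 0 := (Finsupp.degree_eq_zero_iff _).1 (by omega)
  rw [h1, h3, add_zero]

theorem IsTruncatedHomogenization.mem_basis_of_degree_eq (h : IsTruncatedHomogenization j m J)
    {δ : Fin (n + 1) →₀ ℕ} (hδ : Finsupp.tail δ ∈ monomialsIn j) (hd : δ.degree = m) :
    δ ∈ monomialBasis J := by
  refine ⟨(h δ).2 ⟨hδ, hd.ge⟩, fun ε hε hle => ?_⟩
  exact (eq_of_le_of_degree_le hle (hd ▸ ((h ε).1 hε).2)).ge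

theorem IsTruncatedHomogenization.cons_mem_basis (h : IsTruncatedHomogenization j m J)
    {α : Fin n →₀ ℕ} (hα : α ∈ monomialBasis j) :
    Finsupp.cons (max m α.degree - α.degree) α ∈ monomialBasis J := by
  refine ⟨(h _).2 ⟨by simpa using hα.1, by rw [degree_cons]; omega⟩, fun ε hε hle => ?_⟩
  obtain ⟨h1, h2⟩ := (h ε).1 hε
  have h3 := tail_le_tail hle
  rw [Finsupp.tail_cons] at h3
  have h4 : Finsupp.tail ε = α := le_antisymm h3 (hα.2 h1 h3)
  rw [degree_eq_zero_add_tail, h4] at h2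
  intro i
  induction i using Fin.cases with
  | zero => rw [Finsupp.cons_zero]; omega
  | succ i => rw [Finsupp.cons_succ, ← h4, Finsupp.tail_apply]

/-- Above degree `m`, dividing by one variable stays in degree at least `m`, so by minimality the
dehomogenization must leave `j`. This excludes `x₀` and makes the dehomogenized monomial minimal. -/
theorem IsTruncatedHomogenization.of_mem_basis (h : IsTruncatedHomogenization j m J)
    {δ : Fin (n + 1) →₀ ℕ} (hδ : δ ∈ monomialBasis J) :
    Finsupp.tail δ ∈ monomialsIn j ∧
      (δ.degree = m ∨ m < δ.degree ∧ δ 0 = 0 ∧ Finsupp.tail δ ∈ monomialBasis j) := by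
  obtain ⟨h1, h2⟩ := (h δ).1 hδ.1
  refine ⟨h1, h2.eq_or_lt.imp Eq.symm fun hlt => ⟨hlt, ?_⟩⟩
  have key : ∀ i, 0 < δ i → Finsupp.tail (δ - Finsupp.single i 1) ∉ monomialsIn j := by
    intro i hi hmem
    have hd := degree_tsub_single hi
    have := hδ.2 ((h _).2 ⟨hmem, by omega⟩) tsub_le_self i
    simp at this
    omega
  constructor
  · by_contra h0
    refine key 0 (Nat.pos_of_ne_zero h0) ?_
    convert h1 using 1
    ext x
    simp [Finsupp.tail_apply]
  · refine ⟨h1, fun β hβ hle => ?_⟩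
    by_contra hnle
    obtain ⟨i, hi⟩ := exists_lt_of_not_le hnle
    rw [Finsupp.tail_apply] at hi
    refine key i.succ (by omega) (mem_monomialsIn_of_le hβ fun x => ?_)
    have hx := hle x
    rw [Finsupp.tail_apply] at hx ⊢
    by_cases hix : i = x
    · subst hix; simp; omega
    · have : i.succ ≠ x.succ := fun h => hix (Fin.succ_injective _ h)
      simpa [Finsupp.single_apply, this, hix] using hx

theorem mem_affTail {α γ : Fin n →₀ ℕ} :
    γ ∈ affTail j m α ↔ γ.degree ≤ max m α.degree ∧ γ ∉ monomialsIn j := by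
  classical
  rw [affTail, Finset.mem_filter, mem_expsLE]

theorem mem_homTail {δ ε : Fin n →₀ ℕ} :
    ε ∈ homTail j δ ↔ ε.degree = δ.degree ∧ ε ∉ monomialsIn j := by
  classical
  rw [homTail, Finset.mem_filter, mem_expsEq]

/-- The index of the coefficient of `x₀^{d-|γ|} x^γ` in the polynomial with head term
`x₀^{d-|α|} x^α`, where `d = max {m, |α|}`. -/
noncomputable def IsTruncatedHomogenization.idx (h : IsTruncatedHomogenization j m J)
    (p : AffIdx j m) :
    HomIdx J :=
  ⟨⟨Finsupp.cons (max m (p.1.1).degree - (p.1.1).degree) p.1.1, h.cons_mem_basis p.1.2⟩,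
    ⟨Finsupp.cons (max m (p.1.1).degree - (p.2.1).degree) p.2.1, by
      obtain ⟨h1, h2⟩ := mem_affTail.1 p.2.2
      refine mem_homTail.2 ⟨by rw [degree_cons, degree_cons]; omega, fun h' => h2 ?_⟩
      simpa using ((h _).1 h').1⟩⟩

end Truncation

/-! ### Uniqueness of reduced forms and of marked generators. -/

section MarkedIdeals

variable {K : Type u} [Field K] {n : ℕ} {J : Ideal (MvPolynomial (Fin n) K)}
variable {T : (Fin n →₀ ℕ) → Finset (Fin n →₀ ℕ)} {A : Type v} [CommRing A]

theorem mem_span_monomial_iff {P : (Fin n →₀ ℕ) → Prop} {p : MvPolynomial (Fin n) A} :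
    p ∈ Submodule.span A {p : MvPolynomial (Fin n) A | ∃ γ, P γ ∧ p = monomial γ 1} ↔
      ∀ γ, ¬ P γ → coeff γ p = 0 := by
  classical
  constructor
  · intro h γ hγ
    induction h using Submodule.span_induction with
    | mem x hx =>
      obtain ⟨δ, hδ, rfl⟩ := hx
      rw [coeff_monomial, if_neg]
      rintro rfl
      exact hγ hδ
    | zero => simp
    | add x y _ _ hx hy => rw [coeff_add, hx, hy, add_zero]
    | smul a x _ hx => rw [coeff_smul, hx, smul_zero]
  · intro h
    rw [p.as_sum]
    refine Submodule.sum_mem _ fun γ hγ => ?_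
    have : monomial γ (coeff γ p) = coeff γ p • monomial γ (1 : A) := by
      rw [smul_monomial, smul_eq_mul, mul_one]
    rw [this]
    refine Submodule.smul_mem _ _ (Submodule.subset_span ⟨γ, ?_, rfl⟩)
    by_contra h0
    exact (mem_support_iff.1 hγ) (h γ h0)

theorem isReducedPoly_iff_mem_span {p : MvPolynomial (Fin n) A} :
    IsReducedPoly J p ↔ p ∈ Submodule.span A
      {p : MvPolynomial (Fin n) A | ∃ γ : Fin n →₀ ℕ, γ ∉ monomialsIn J ∧ p = monomial γ 1} := by
  rw [mem_span_monomial_iff, isReducedPoly_iff]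
  simp only [not_not]

/-- The ideal `I` contains no reduced polynomial except `0`. -/
def HasNoReduced (J : Ideal (MvPolynomial (Fin n) K)) (I : Ideal (MvPolynomial (Fin n) A)) : Prop :=
  ∀ p ∈ I, IsReducedPoly J p → p = 0

theorem HasNoReduced.eq_of_sub_mem {I : Ideal (MvPolynomial (Fin n) A)} (h : HasNoReduced J I)
    {p r r' : MvPolynomial (Fin n) A} (hr : IsReducedPoly J r) (hr' : IsReducedPoly J r')
    (h1 : p - r ∈ I) (h2 : p - r' ∈ I) : r = r' := by
  rw [← sub_eq_zero]
  refine h _ ?_ (hr.sub hr')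
  have := sub_mem h2 h1
  rwa [sub_sub_sub_cancel_left] at this

theorem markedPoly_mem {B : Set (Fin n →₀ ℕ)} (c : CoeffIdx B T → A) (α : {α // α ∈ B}) :
    markedPoly c α ∈ markedIdeal c :=
  Ideal.subset_span ⟨α, rfl⟩

/-- Each tail is a reduced form of its head modulo `I`, and such forms are unique. -/
theorem eq_of_markedPoly_mem (hT : ∀ α, ∀ γ ∈ T α, γ ∉ monomialsIn J)
    {c c' : CoeffIdx (monomialBasis J) T → A} {I : Ideal (MvPolynomial (Fin n) A)}
    (hI : HasNoReduced J I) (h : ∀ α, markedPoly c α ∈ I) (h' : ∀ α, markedPoly c' α ∈ I) :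
    c = c' := by
  refine markedPoly_injective fun α => ?_
  have := hI.eq_of_sub_mem (p := monomial α.1 1) (hasReducedTails_markedPoly hT c α)
    (hasReducedTails_markedPoly hT c' α) (by simpa using h α) (by simpa using h' α)
  exact sub_right_injective this

theorem eq_of_markedIdeal_eq (hT : ∀ α, ∀ γ ∈ T α, γ ∉ monomialsIn J)
    {c c' : CoeffIdx (monomialBasis J) T → A} (hc : HasNoReduced J (markedIdeal c))
    (h : markedIdeal c = markedIdeal c') : c = c' :=
  eq_of_markedPoly_mem hT hc (markedPoly_mem c) fun α => h ▸ markedPoly_mem c' α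

theorem mem_points_span {C : Type} [Algebra K A] {S : Set (MvPolynomial C K)} {c : C → A} :
    c ∈ points (Ideal.span S) A ↔ ∀ p ∈ S, aeval c p = 0 := by
  constructor
  · intro h p hp
    exact h p (Ideal.subset_span hp)
  · intro h p hp
    have : Ideal.span S ≤ RingHom.ker (aeval c : MvPolynomial C K →ₐ[K] A) :=
      Ideal.span_le.2 h
    exact this hp

end MarkedIdeals

/-! ### The homogeneous family and its points. -/

section HomogeneousFamily

variable {K : Type u} [Field K] {n : ℕ} {J : Ideal (MvPolynomial (Fin n) K)}
variable {A : Type v} [CommRing A]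

theorem notMem_of_mem_homTail : ∀ α, ∀ γ ∈ homTail J α, γ ∉ monomialsIn J :=
  fun _ _ h => (mem_homTail.1 h).2

theorem mem_points_homIdeal [Algebra K A] (hJ : IsBorelClosed J) {c : HomIdx J → A} :
    c ∈ points (homIdeal J) A ↔ HasNoReduced J (markedIdeal c) := by
  rw [homIdeal, mem_points_span, HasNoReduced,
    ← forall_aeval_coeff_eq_zero_iff hJ notMem_of_mem_homTail]
  constructor
  · intro h p hp hr γ
    exact h _ ⟨p, γ, hp, hr, rfl⟩
  · rintro h _ ⟨p, γ, hp, hr, rfl⟩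
    exact h p hp hr γ

theorem isHomogeneous_markedPoly (c : HomIdx J → A) (α : {α // α ∈ monomialBasis J}) :
    (markedPoly c α).IsHomogeneous α.1.degree := by
  refine (isHomogeneous_monomial _ rfl).sub (IsHomogeneous.sum _ _ _ fun γ _ => ?_)
  exact isHomogeneous_monomial _ (mem_homTail.1 γ.2).1

theorem containsComponents_markedIdeal (c : HomIdx J → A) :
    ContainsComponents (markedIdeal c) := by
  refine containsComponents_span ?_
  rintro _ ⟨α, rfl⟩
  exact ⟨_, isHomogeneous_markedPoly c α⟩

theorem markedIdeal_mem_homFamily (hJ : IsBorelClosed J) {c : HomIdx J → A}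
    (hc : HasNoReduced J (markedIdeal c)) : markedIdeal c ∈ homFamily J A := by
  refine ⟨containsComponents_markedIdeal c, ?_, ?_⟩
  · rw [Submodule.disjoint_def]
    intro p hp hr
    exact hc p hp (isReducedPoly_iff_mem_span.2 hr)
  · rw [codisjoint_iff, eq_top_iff]
    intro p _
    obtain ⟨r, hr, hm⟩ :=
      exists_isReducedPoly hJ (hasReducedTails_markedPoly notMem_of_mem_homTail c) p
    rw [← sub_add_cancel p r]
    exact Submodule.add_mem_sup hm (isReducedPoly_iff_mem_span.1 hr)

theorem IsReducedPoly.homogeneousComponent {p : MvPolynomial (Fin n) A} (hp : IsReducedPoly J p)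
    (t : ℕ) : IsReducedPoly J (homogeneousComponent t p) := by
  rw [isReducedPoly_iff] at *
  intro γ hγ
  rw [coeff_homogeneousComponent, hp γ hγ, ite_self]

/-- The tail of `x^α` is the degree-`|α|` component of its projection to the span of `N(J)`. The
resulting marked ideal is all of `I`, since a reduced remainder of an element of `I` lies in `I` and
vanishes. -/
theorem exists_of_mem_homFamily (hJ : IsBorelClosed J) {I : Ideal (MvPolynomial (Fin n) A)}
    (hI : I ∈ homFamily J A) :
    ∃ c : HomIdx J → A, HasNoReduced J (markedIdeal c) ∧ markedIdeal c = I := by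
  obtain ⟨hcomp, hdisj, hcod⟩ := hI
  have hno : HasNoReduced J I := fun p hp hr =>
    (Submodule.disjoint_def.1 hdisj) p hp (isReducedPoly_iff_mem_span.1 hr)
  have hex : ∀ α : {α // α ∈ monomialBasis J}, ∃ r : MvPolynomial (Fin n) A,
      IsReducedPoly J r ∧ r.IsHomogeneous α.1.degree ∧ monomial α.1 1 - r ∈ I := by
    intro α
    have : monomial α.1 (1 : A) ∈ (⊤ : Submodule A (MvPolynomial (Fin n) A)) := trivial
    rw [← codisjoint_iff.1 hcod] at this
    obtain ⟨q, hq, r, hr, hqr⟩ := Submodule.mem_sup.1 this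
    rw [← isReducedPoly_iff_mem_span] at hr
    refine ⟨homogeneousComponent α.1.degree r, hr.homogeneousComponent _,
      homogeneousComponent_isHomogeneous _ _, ?_⟩
    have h1 := hcomp q hq α.1.degree
    rw [eq_sub_of_add_eq hqr, map_sub,
      homogeneousComponent_eq_self (isHomogeneous_monomial _ rfl)] at h1
    exact h1
  choose r hr hrh hrI using hex
  have hmp : ∀ α, markedPoly (fun p : HomIdx J => coeff p.2.1 (r p.1)) α =
      monomial α.1 1 - r α := by
    refine markedPoly_coeff r fun α γ hγ => ?_
    rw [mem_homTail, not_and_not_right] at hγ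
    by_cases hd : γ.degree = α.1.degree
    · exact isReducedPoly_iff.1 (hr α) γ (hγ hd)
    · exact (hrh α).coeff_eq_zero hd
  set c := fun p : HomIdx J => coeff p.2.1 (r p.1) with hc
  have hle : markedIdeal c ≤ I := by
    refine Ideal.span_le.2 ?_
    rintro _ ⟨α, rfl⟩
    rw [hmp]
    exact hrI α
  refine ⟨c, fun p hp => hno p (hle hp), le_antisymm hle fun p hp => ?_⟩
  obtain ⟨s, hs, hm⟩ :=
    exists_isReducedPoly hJ (hasReducedTails_markedPoly notMem_of_mem_homTail c) p
  have h0 : s = 0 := by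
    refine hno s ?_ hs
    have := sub_mem hp (hle hm)
    rwa [sub_sub_cancel] at this
  rwa [h0, sub_zero] at hm

end HomogeneousFamily

/-! ### The equations of the affine family. -/

section AffinePoints

variable {K : Type u} [Field K] {n m : ℕ} {j : Ideal (MvPolynomial (Fin n) K)}
variable {A : Type v} [CommRing A]

theorem notMem_of_mem_affTail : ∀ α, ∀ γ ∈ affTail j m α, γ ∉ monomialsIn j :=
  fun _ _ h => (mem_affTail.1 h).2

/-- The ideal `I` contains no reduced polynomial except `0`, and modulo `I` each monomial of
`j_{≤ m}` is congruent to a reduced polynomial of degree at most `m`. -/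
structure HasBoundedReduction (j : Ideal (MvPolynomial (Fin n) K)) (m : ℕ)
    (I : Ideal (MvPolynomial (Fin n) A)) : Prop where
  hasNoReduced : HasNoReduced j I
  exists_reduced : ∀ β ∈ monomialsIn j, β.degree ≤ m →
    ∃ r, IsReducedPoly j r ∧ r.totalDegree ≤ m ∧ monomial β 1 - r ∈ I

theorem totalDegree_tail_le (b : AffIdx j m → A) (α : {α // α ∈ monomialBasis j}) :
    (monomial α.1 1 - markedPoly b α).totalDegree ≤ max m α.1.degree := by
  refine totalDegree_le_of_coeff fun γ hγ => ?_
  rw [coeff_sub, coeff_markedPoly, dif_neg, sub_zero, sub_self]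
  intro h
  have := (mem_affTail.1 h).1
  omega

/-- `D₂` amounts to uniqueness of reduced forms. Given that, every reduction of `x^β` specializes to
the same polynomial, so `D₁` bounds the degree of the reduced form; for `x^β` in `B_j` the tail
already satisfies the bound. -/
theorem mem_points_affIdeal [Algebra K A] (hj : IsBorelClosed j) {b : AffIdx j m → A} :
    b ∈ points (affIdeal j m) A ↔ HasBoundedReduction j m (markedIdeal b) := by
  have hD₂ : (∀ a ∈ D₂ j m, aeval b a = 0) ↔ HasNoReduced j (markedIdeal b) := by
    rw [HasNoReduced, ← forall_aeval_coeff_eq_zero_iff hj notMem_of_mem_affTail]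
    constructor
    · intro h p hp hr γ
      exact h _ ⟨p, γ, hp, hr, rfl⟩
    · rintro h _ ⟨p, γ, hp, hr, rfl⟩
      exact h p hp hr γ
  rw [affIdeal, mem_points_span]
  set φ := (aeval b : MvPolynomial (AffIdx j m) K →ₐ[K] A).toRingHom with hφ
  have hmap : ∀ {β g}, ReducesTo j (affGeneric j m) (monomial β 1) g →
      monomial β 1 - MvPolynomial.map φ g ∈ markedIdeal b := by
    intro β g hg
    have := map_mem_markedIdeal b hg.sub_mem
    rwa [map_sub, map_monomial, map_one] at this
  constructor
  · intro h
    refine ⟨hD₂.1 fun a ha => h a (Or.inr ha), fun β hβ hd => ?_⟩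
    by_cases hB : β ∈ monomialBasis j
    · refine ⟨_, hasReducedTails_markedPoly notMem_of_mem_affTail b ⟨β, hB⟩, ?_, ?_⟩
      · exact (totalDegree_tail_le b ⟨β, hB⟩).trans (max_le le_rfl hd)
      · rw [sub_sub_cancel]
        exact markedPoly_mem _ _
    · obtain ⟨g, hg, hr⟩ := exists_reducesTo hj
        (hasReducedTails_markedPoly notMem_of_mem_affTail
          (X : AffIdx j m → MvPolynomial (AffIdx j m) K)) (monomial β 1)
      refine ⟨MvPolynomial.map φ g, hr.map _, ?_, hmap hg⟩
      refine totalDegree_le_of_coeff fun γ hγ => ?_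
      rw [coeff_map]
      exact h _ (Or.inl ⟨β, g, γ, hβ, hd, hB, hg, hr, hγ, rfl⟩)
  · intro h a ha
    rcases ha with ⟨β, g, γ, hβ, hd, hB, hg, hr, hγ, rfl⟩ | ha
    · obtain ⟨r, hr', hdr, hm⟩ := h.exists_reduced β hβ hd
      have heq := h.hasNoReduced.eq_of_sub_mem hr' (hr.map φ) hm (hmap hg)
      have : coeff γ (MvPolynomial.map φ g) = 0 := by
        rw [← heq]
        exact coeff_eq_zero_of_totalDegree_lt_degree (by omega)
      rwa [coeff_map] at this
    · exact hD₂.2 h.hasNoReduced a ha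

end AffinePoints

/-! ### Passing between homogeneous and affine marked ideals. -/

section Correspondence

variable {K : Type u} [Field K] {n m : ℕ} {j : Ideal (MvPolynomial (Fin n) K)}
  {J : Ideal (MvPolynomial (Fin (n + 1)) K)} {A : Type v} [CommRing A]

namespace IsTruncatedHomogenization

variable (h : IsTruncatedHomogenization j m J)
include h

theorem isReducedPoly_of_dehomogenization {F : MvPolynomial (Fin (n + 1)) A} {t : ℕ}
    (hF : F.IsHomogeneous t) (hr : IsReducedPoly j (dehomogenization A n F)) :
    IsReducedPoly J F := by
  rw [isReducedPoly_iff] at *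
  intro δ hδ
  by_cases hd : δ.degree = t
  · rw [← coeff_tail_dehomogenization hF hd]
    exact hr _ ((h δ).1 hδ).1
  · exact hF.coeff_eq_zero hd

theorem isReducedPoly_dehomogenization {F : MvPolynomial (Fin (n + 1)) A} {t : ℕ}
    (hF : F.IsHomogeneous t) (ht : m ≤ t) (hr : IsReducedPoly J F) :
    IsReducedPoly j (dehomogenization A n F) := by
  rw [isReducedPoly_iff] at *
  intro γ hγ
  rw [coeff_dehomogenization hF]
  split_ifs with hd
  · exact hr _ ((h _).2 ⟨by simpa using hγ, by rw [degree_cons]; omega⟩)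
  · rfl

theorem le_degree_of_mem_basis (δ : {δ // δ ∈ monomialBasis J}) : m ≤ δ.1.degree :=
  ((h δ.1).1 δ.2.1).2

theorem dehomogenization_markedPoly (c : HomIdx J → A) (α : {α // α ∈ monomialBasis j}) :
    dehomogenization A n (markedPoly c ⟨_, h.cons_mem_basis α.2⟩) =
      markedPoly (c ∘ h.idx) α := by
  classical
  ext γ
  rw [coeff_dehomogenization (isHomogeneous_markedPoly c _), coeff_markedPoly, coeff_markedPoly]
  have hdeg : (Finsupp.cons (max m α.1.degree - α.1.degree) α.1).degree = max m α.1.degree := by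
    rw [degree_cons]; omega
  simp only [hdeg]
  split_ifs with h1 h2 h3 h3 h3
  · congr 1
    rw [coeff_monomial, coeff_monomial]
    refine if_congr ⟨fun he => ?_, fun he => by rw [he]⟩ rfl rfl
    simpa using congrArg Finsupp.tail he
  · refine absurd ?_ h3
    rw [mem_homTail, hdeg, h] at h2
    refine mem_affTail.2 ⟨h1, fun h4 => h2.2 ⟨by simpa using h4, ?_⟩⟩
    rw [h2.1]
    omega
  · refine absurd ?_ h2
    rw [mem_homTail, hdeg, h, degree_cons]
    exact ⟨by omega, fun h4 => (mem_affTail.1 h3).2 (by simpa using h4.1)⟩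
  · congr 1
    rw [coeff_monomial, coeff_monomial]
    refine if_congr ⟨fun he => ?_, fun he => by rw [he]⟩ rfl rfl
    simpa using congrArg Finsupp.tail he
  · exact absurd (mem_affTail.1 h3).1 h1
  · rw [coeff_monomial, if_neg, sub_zero]
    rintro rfl
    exact h1 (le_max_right _ _)

theorem hasNoReduced_dehomogenizationIdeal {I : Ideal (MvPolynomial (Fin (n + 1)) A)}
    (hI : ContainsComponents I) (hno : HasNoReduced J I) :
    HasNoReduced j (dehomogenizationIdeal I) := by
  intro q hq hr
  obtain ⟨F, hF, t, ht, rfl⟩ := exists_isHomogeneous_of_mem_dehomogenizationIdeal hI hq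
  rw [hno F hF (h.isReducedPoly_of_dehomogenization ht hr), map_zero]

theorem dehomogenizationIdeal_markedIdeal (hj : IsBorelClosed j) {c : HomIdx J → A}
    (hc : HasNoReduced J (markedIdeal c)) :
    dehomogenizationIdeal (markedIdeal c) = markedIdeal (c ∘ h.idx) := by
  have hle : markedIdeal (c ∘ h.idx) ≤ dehomogenizationIdeal (markedIdeal c) := by
    refine Ideal.span_le.2 ?_
    rintro _ ⟨α, rfl⟩
    rw [← h.dehomogenization_markedPoly]
    exact mem_dehomogenizationIdeal (markedPoly_mem _ _)
  refine le_antisymm (fun p hp => ?_) hle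
  obtain ⟨r, hr, hm⟩ := exists_isReducedPoly hj
    (hasReducedTails_markedPoly notMem_of_mem_affTail (c ∘ h.idx)) p
  have h0 : r = 0 := by
    refine h.hasNoReduced_dehomogenizationIdeal (containsComponents_markedIdeal c) hc r ?_ hr
    have := sub_mem hp (hle hm)
    rwa [sub_sub_cancel] at this
  rwa [h0, sub_zero] at hm

/-- The monomial `x₀^{m-|β|} x^β` has degree `m`, hence is in `B_J`; dehomogenizing its marked
polynomial bounds the reduced form of `x^β`. -/
theorem hasBoundedReduction (hj : IsBorelClosed j) {c : HomIdx J → A}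
    (hc : HasNoReduced J (markedIdeal c)) :
    HasBoundedReduction j m (markedIdeal (c ∘ h.idx)) := by
  rw [← h.dehomogenizationIdeal_markedIdeal hj hc]
  refine ⟨h.hasNoReduced_dehomogenizationIdeal (containsComponents_markedIdeal c) hc,
    fun β hβ hd => ?_⟩
  have hdeg : (Finsupp.cons (m - β.degree) β).degree = m := by rw [degree_cons]; omega
  have hB := h.mem_basis_of_degree_eq (δ := Finsupp.cons (m - β.degree) β) (by simpa using hβ) hdeg
  set δ : {δ // δ ∈ monomialBasis J} := ⟨_, hB⟩ with hδ
  have hhom : (monomial δ.1 1 - markedPoly c δ).IsHomogeneous m := by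
    rw [← hdeg]
    exact (isHomogeneous_monomial _ rfl).sub (isHomogeneous_markedPoly c δ)
  refine ⟨dehomogenization A n (monomial δ.1 1 - markedPoly c δ),
    h.isReducedPoly_dehomogenization hhom le_rfl
      (hasReducedTails_markedPoly notMem_of_mem_homTail c δ),
    totalDegree_dehomogenization_le hhom, ?_⟩
  rw [map_sub, dehomogenization_monomial, Finsupp.tail_cons, sub_sub_cancel]
  exact mem_dehomogenizationIdeal (markedPoly_mem _ _)

/-- Argue on homogeneous components. From degree `m` on, dehomogenization preserves reducedness;
below degree `m` the ideal is zero because all heads have degree at least `m`. -/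
theorem hasNoReduced_of_dehomogenization {c : HomIdx J → A} {I : Ideal (MvPolynomial (Fin n) A)}
    (hI : HasNoReduced j I) (hc : ∀ F ∈ markedIdeal c, dehomogenization A n F ∈ I) :
    HasNoReduced J (markedIdeal c) := by
  intro p hp hr
  rw [← sum_homogeneousComponent p]
  refine Finset.sum_eq_zero fun t _ => ?_
  have hpt := containsComponents_markedIdeal c p hp t
  have hh := homogeneousComponent_isHomogeneous t p
  by_cases ht : m ≤ t
  · refine eq_of_dehomogenization_eq hh (isHomogeneous_zero _ _ _) ?_
    rw [map_zero]
    exact hI _ (hc _ hpt) (h.isReducedPoly_dehomogenization hh ht (hr.homogeneousComponent t))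
  · ext δ
    rw [coeff_zero]
    by_cases hd : δ.degree = t
    · refine coeff_eq_zero_of_mem_span (m := m) ?_ hpt (by omega)
      rintro _ ⟨α, rfl⟩ ε hε
      have := h.le_degree_of_mem_basis α
      exact (isHomogeneous_markedPoly c α).coeff_eq_zero (by omega)
    · exact hh.coeff_eq_zero hd

/-- A head of degree `m` takes its tail from the bounded reduced form, one of larger degree from the
marked polynomial of `b` itself; both are homogenized to the degree of the head. Uniqueness of tails
shows that the projection is `b`. -/
theorem exists_comp_idx_eq {b : AffIdx j m → A}
    (hb : HasBoundedReduction j m (markedIdeal b)) :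
    ∃ c : HomIdx J → A, HasNoReduced J (markedIdeal c) ∧ c ∘ h.idx = b := by
  have hex : ∀ δ : {δ // δ ∈ monomialBasis J}, ∃ r : MvPolynomial (Fin n) A,
      IsReducedPoly j r ∧ r.totalDegree ≤ δ.1.degree ∧
        monomial (Finsupp.tail δ.1) 1 - r ∈ markedIdeal b := by
    intro δ
    obtain ⟨h1, h2 | ⟨h2, h3, h4⟩⟩ := h.of_mem_basis δ.2
    · rw [h2]
      refine hb.exists_reduced _ h1 ?_
      rw [← h2, degree_eq_zero_add_tail]
      exact Nat.le_add_left _ _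
    · refine ⟨_, hasReducedTails_markedPoly notMem_of_mem_affTail b ⟨_, h4⟩, ?_, ?_⟩
      · refine (totalDegree_tail_le b ⟨_, h4⟩).trans ?_
        rw [degree_eq_zero_add_tail] at h2 ⊢
        simp only [sup_le_iff]
        omega
      · rw [sub_sub_cancel]
        exact markedPoly_mem _ _
  choose r hr hrd hrI using hex
  have hmp : ∀ δ, markedPoly
      (fun p : HomIdx J => coeff p.2.1 (homogenizationAt p.1.1.degree (r p.1))) δ =
      monomial δ.1 1 - homogenizationAt δ.1.degree (r δ) := by
    refine markedPoly_coeff (fun δ => homogenizationAt δ.1.degree (r δ)) fun δ γ hγ => ?_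
    have hh := isHomogeneous_homogenizationAt (hrd δ)
    rw [mem_homTail, not_and_not_right] at hγ
    by_cases hd : γ.degree = δ.1.degree
    · refine isReducedPoly_iff.1 (h.isReducedPoly_of_dehomogenization hh ?_) γ (hγ hd)
      rw [dehomogenization_homogenizationAt]
      exact hr δ
    · exact hh.coeff_eq_zero hd
  set c := fun p : HomIdx J => coeff p.2.1 (homogenizationAt p.1.1.degree (r p.1)) with hc
  have hgen : ∀ δ, dehomogenization A n (markedPoly c δ) ∈ markedIdeal b := by
    intro δ
    rw [hmp, map_sub, dehomogenization_monomial, dehomogenization_homogenizationAt]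
    exact hrI δ
  refine ⟨c, h.hasNoReduced_of_dehomogenization hb.hasNoReduced fun F hF => ?_, ?_⟩
  · have : markedIdeal c ≤ (markedIdeal b).comap (dehomogenization A n) := by
      refine Ideal.span_le.2 ?_
      rintro _ ⟨δ, rfl⟩
      exact hgen δ
    exact this hF
  · refine eq_of_markedPoly_mem notMem_of_mem_affTail hb.hasNoReduced (fun α => ?_)
      (markedPoly_mem b)
    rw [← h.dehomogenization_markedPoly]
    exact hgen _

/-- For the inclusion into `markedIdeal c`, the reduced remainder of a homogeneous element of degree
at least `m` dehomogenizes, in that degree, to a reduced element of the affine ideal, hence is zero.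
-/
theorem truncation_homogenizationIdeal_markedIdeal (hj : IsBorelClosed j) {c : HomIdx J → A}
    (hc : HasNoReduced J (markedIdeal c)) :
    truncation (homogenizationIdeal (markedIdeal (c ∘ h.idx))) m = markedIdeal c := by
  have hd := h.dehomogenizationIdeal_markedIdeal hj hc
  apply le_antisymm
  · refine Ideal.span_le.2 ?_
    rintro F ⟨hF, t, ht, hh⟩
    obtain ⟨r, hr, hm⟩ := exists_isReducedPoly (h.isBorelClosed hj)
      (hasReducedTails_markedPoly notMem_of_mem_homTail c) F
    have hm' := containsComponents_markedIdeal c _ hm t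
    rw [map_sub, homogeneousComponent_eq_self hh] at hm'
    have hrt := homogeneousComponent_isHomogeneous t r
    have h0 : homogeneousComponent t r = 0 := by
      refine eq_of_dehomogenization_eq hrt (isHomogeneous_zero _ _ _) ?_
      rw [map_zero]
      refine (h.hasBoundedReduction hj hc).hasNoReduced _ ?_
        (h.isReducedPoly_dehomogenization hrt ht (hr.homogeneousComponent t))
      have h1 := mem_dehomogenizationIdeal hm'
      have h2 := mem_dehomogenizationIdeal hF
      rw [dehomogenizationIdeal_homogenizationIdeal] at h2
      rw [hd, map_sub] at h1
      have := sub_mem h2 h1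
      rwa [sub_sub_cancel] at this
    rwa [h0, sub_zero] at hm'
  · refine Ideal.span_le.2 ?_
    rintro _ ⟨δ, rfl⟩
    refine mem_truncation_homogenizationIdeal (isHomogeneous_markedPoly c δ)
      (h.le_degree_of_mem_basis δ) ?_
    rw [← hd]
    exact mem_dehomogenizationIdeal (markedPoly_mem _ _)

/-- The projected point determines the affine ideal, whose truncated homogenization is the ideal of
`c`, which determines `c`. -/
theorem eq_of_comp_idx_eq (hj : IsBorelClosed j) {c c' : HomIdx J → A}
    (hc : HasNoReduced J (markedIdeal c)) (hc' : HasNoReduced J (markedIdeal c'))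
    (heq : c ∘ h.idx = c' ∘ h.idx) : c = c' := by
  refine eq_of_markedIdeal_eq notMem_of_mem_homTail hc ?_
  rw [← h.truncation_homogenizationIdeal_markedIdeal hj hc, heq,
    h.truncation_homogenizationIdeal_markedIdeal hj hc']

end IsTruncatedHomogenization

end Correspondence

/-! ### Marked bases and the bijection of families. -/

section MarkedBases

variable {K : Type u} [Field K] {n m : ℕ} {j : Ideal (MvPolynomial (Fin n) K)}
  {J : Ideal (MvPolynomial (Fin (n + 1)) K)} {A : Type v} [CommRing A]

theorem mem_span_monomial_degree_le_iff {t : ℕ} {p : MvPolynomial (Fin n) A} :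
    p ∈ Submodule.span A {p : MvPolynomial (Fin n) A |
      ∃ γ : Fin n →₀ ℕ, γ ∉ monomialsIn j ∧ γ.degree ≤ t ∧ p = monomial γ 1} ↔
    IsReducedPoly j p ∧ p.totalDegree ≤ t := by
  simp only [← and_assoc]
  rw [mem_span_monomial_iff, isReducedPoly_iff]
  constructor
  · intro h
    exact ⟨fun γ hγ => h γ fun h' => h'.1 hγ,
      totalDegree_le_of_coeff fun γ hγ => h γ fun h' => not_lt.2 h'.2 hγ⟩
  · rintro ⟨h1, h2⟩ γ hγ
    rw [not_and, not_le] at hγ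
    by_cases hj : γ ∈ monomialsIn j
    · exact h1 γ hj
    · exact coeff_eq_zero_of_totalDegree_lt_degree (h2.trans_lt (hγ hj))

/-- Direct affine reduction need not respect degrees. Homogenizing to degree `t`, reducing there and
dehomogenizing keeps both summands in degree at most `t`. -/
theorem IsTruncatedHomogenization.isAffMarkedBasis (h : IsTruncatedHomogenization j m J)
    (hj : IsBorelClosed j) {b : AffIdx j m → A}
    (hb : HasBoundedReduction j m (markedIdeal b)) : IsAffMarkedBasis j m (markedPoly b) := by
  refine ⟨fun α γ hγ => ⟨hasReducedTails_markedPoly notMem_of_mem_affTail b α γ hγ,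
    (degree_le_totalDegree hγ).trans (totalDegree_tail_le b α)⟩, fun t ht => ?_⟩
  intro N I
  constructor
  · rw [Submodule.disjoint_def]
    intro p hN hI
    exact hb.hasNoReduced p hI.1 (mem_span_monomial_degree_le_iff.1 hN).1
  · refine le_antisymm (sup_le (fun p hp => ?_) inf_le_right) fun p hp => ?_
    · exact (mem_restrictTotalDegree _ _ _).2 (mem_span_monomial_degree_le_iff.1 hp).2
    · obtain ⟨c, hc, rfl⟩ := h.exists_comp_idx_eq hb
      have hp' := (mem_restrictTotalDegree _ _ _).1 hp
      have hh := isHomogeneous_homogenizationAt hp'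
      obtain ⟨r, hr, hm⟩ := exists_isReducedPoly (h.isBorelClosed hj)
        (hasReducedTails_markedPoly notMem_of_mem_homTail c) (homogenizationAt t p)
      have hm' := containsComponents_markedIdeal c _ hm t
      rw [map_sub, homogeneousComponent_eq_self hh] at hm'
      have hrt := homogeneousComponent_isHomogeneous t r
      have h1 := mem_dehomogenizationIdeal hm'
      rw [map_sub, dehomogenization_homogenizationAt,
        h.dehomogenizationIdeal_markedIdeal hj hc] at h1
      have hN : dehomogenization A n (homogeneousComponent t r) ∈ N :=
        mem_span_monomial_degree_le_iff.2
          ⟨h.isReducedPoly_dehomogenization hrt ht (hr.homogeneousComponent t),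
            totalDegree_dehomogenization_le hrt⟩
      rw [← add_sub_cancel (dehomogenization A n (homogeneousComponent t r)) p]
      refine Submodule.add_mem_sup hN ⟨h1, sub_mem hp ?_⟩
      exact (mem_restrictTotalDegree _ _ _).2 (totalDegree_dehomogenization_le hrt)

/-- The decomposition at `t = m` yields the bounded reduced forms; at `t = max m (deg p)` it forces
a reduced `p` of the ideal to vanish. -/
theorem exists_of_isAffMarkedBasis
    {F : {α // α ∈ monomialBasis j} → MvPolynomial (Fin n) A} (hF : IsAffMarkedBasis j m F) :
    ∃ b : AffIdx j m → A, HasBoundedReduction j m (markedIdeal b) ∧ markedPoly b = F := by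
  have hb : markedPoly (fun p : AffIdx j m => coeff p.2.1 (monomial p.1.1 1 - F p.1)) = F := by
    funext α
    rw [markedPoly_coeff (T := affTail j m) (fun α => monomial α.1 1 - F α), sub_sub_cancel]
    intro α γ hγ
    by_contra h0
    obtain ⟨h1, h2⟩ := hF.1 α γ (mem_support_iff.2 h0)
    exact hγ (mem_affTail.2 ⟨h2, h1⟩)
  refine ⟨_, ?_, hb⟩
  rw [markedIdeal, hb]
  constructor
  · intro p hp hr
    obtain ⟨hd, -⟩ := hF.2 (max m p.totalDegree) (le_max_left _ _)
    exact (Submodule.disjoint_def.1 hd) p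
      (mem_span_monomial_degree_le_iff.2 ⟨hr, le_max_right _ _⟩)
      ⟨hp, (mem_restrictTotalDegree _ _ _).2 (le_max_right _ _)⟩
  · intro β _ hd
    obtain ⟨-, hsup⟩ := hF.2 m le_rfl
    have hβ : monomial β (1 : A) ∈ restrictTotalDegree (Fin n) A m := by
      classical
      refine (mem_restrictTotalDegree _ _ _).2 (totalDegree_le_of_coeff fun γ hγ => ?_)
      rw [coeff_monomial, if_neg]
      rintro rfl
      omega
    rw [← hsup] at hβ
    obtain ⟨r, hr, q, hq, hrq⟩ := Submodule.mem_sup.1 hβ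
    obtain ⟨h1, h2⟩ := mem_span_monomial_degree_le_iff.1 hr
    exact ⟨r, h1, h2, by rw [← hrq, add_sub_cancel_left]; exact hq.1⟩

theorem IsTruncatedHomogenization.exists_of_mem_affFamily (h : IsTruncatedHomogenization j m J)
    {I : Ideal (MvPolynomial (Fin n) A)} (hI : I ∈ affFamily j m A) :
    ∃ c : HomIdx J → A, HasNoReduced J (markedIdeal c) ∧ markedIdeal (c ∘ h.idx) = I := by
  obtain ⟨_, hF, rfl⟩ := hI
  obtain ⟨b, hb, rfl⟩ := exists_of_isAffMarkedBasis hF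
  obtain ⟨c, hc, rfl⟩ := h.exists_comp_idx_eq hb
  exact ⟨c, hc, rfl⟩

theorem IsTruncatedHomogenization.invOn_truncation (h : IsTruncatedHomogenization j m J)
    (hj : IsBorelClosed j) :
    Set.InvOn dehomogenizationIdeal
      (fun I : Ideal (MvPolynomial (Fin n) A) => truncation (homogenizationIdeal I) m)
      (affFamily j m A) (homFamily J A) := by
  constructor
  · intro I hI
    obtain ⟨c, hc, rfl⟩ := h.exists_of_mem_affFamily hI
    simp only [h.truncation_homogenizationIdeal_markedIdeal hj hc,
      h.dehomogenizationIdeal_markedIdeal hj hc]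
  · intro I hI
    obtain ⟨c, hc, rfl⟩ := exists_of_mem_homFamily (h.isBorelClosed hj) hI
    simp only [h.dehomogenizationIdeal_markedIdeal hj hc,
      h.truncation_homogenizationIdeal_markedIdeal hj hc]

theorem IsTruncatedHomogenization.bijOn_truncation (h : IsTruncatedHomogenization j m J)
    (hj : IsBorelClosed j) :
    Set.BijOn (fun I : Ideal (MvPolynomial (Fin n) A) => truncation (homogenizationIdeal I) m)
      (affFamily j m A) (homFamily J A) := by
  have hJ := h.isBorelClosed hj
  refine (h.invOn_truncation hj).bijOn (fun I hI => ?_) fun I hI => ?_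
  · obtain ⟨c, hc, rfl⟩ := h.exists_of_mem_affFamily hI
    simp only [h.truncation_homogenizationIdeal_markedIdeal hj hc]
    exact markedIdeal_mem_homFamily hJ hc
  · obtain ⟨c, hc, rfl⟩ := exists_of_mem_homFamily hJ hI
    rw [h.dehomogenizationIdeal_markedIdeal hj hc]
    exact ⟨_, h.isAffMarkedBasis hj (h.hasBoundedReduction hj hc), rfl⟩

end MarkedBases

/-! ### Bijections on points. -/

section Points

variable {K : Type u} [Field K] {n m : ℕ} {j : Ideal (MvPolynomial (Fin n) K)}
  {J : Ideal (MvPolynomial (Fin (n + 1)) K)} {A : Type v} [CommRing A] [Algebra K A]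

namespace IsTruncatedHomogenization

theorem bijOn_affFamily (h : IsTruncatedHomogenization j m J) (hj : IsBorelClosed j) :
    Set.BijOn (fun c : AffIdx j m → A => markedIdeal c) (points (affIdeal j m) A)
      (affFamily j m A) := by
  refine ⟨fun b hb => ?_, fun b hb b' _ heq => ?_, ?_⟩
  · exact ⟨_, h.isAffMarkedBasis hj ((mem_points_affIdeal hj).1 hb), rfl⟩
  · exact eq_of_markedIdeal_eq notMem_of_mem_affTail
      ((mem_points_affIdeal hj).1 hb).hasNoReduced heq
  · rintro _ ⟨F, hF, rfl⟩
    obtain ⟨b, hb, rfl⟩ := exists_of_isAffMarkedBasis hF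
    exact ⟨b, (mem_points_affIdeal hj).2 hb, rfl⟩

theorem bijOn_homFamily (h : IsTruncatedHomogenization j m J) (hj : IsBorelClosed j) :
    Set.BijOn (fun c : HomIdx J → A => markedIdeal c) (points (homIdeal J) A)
      (homFamily J A) := by
  have hJ := h.isBorelClosed hj
  refine ⟨fun c hc => ?_, fun c hc c' _ heq => ?_, fun I hI => ?_⟩
  · exact markedIdeal_mem_homFamily hJ ((mem_points_homIdeal hJ).1 hc)
  · exact eq_of_markedIdeal_eq notMem_of_mem_homTail ((mem_points_homIdeal hJ).1 hc) heq
  · obtain ⟨c, hc, rfl⟩ := exists_of_mem_homFamily hJ hI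
    exact ⟨c, (mem_points_homIdeal hJ).2 hc, rfl⟩

theorem comp_idx_mem_points (h : IsTruncatedHomogenization j m J) (hj : IsBorelClosed j)
    {c : HomIdx J → A} (hc : c ∈ points (homIdeal J) A) :
    c ∘ h.idx ∈ points (affIdeal j m) A :=
  (mem_points_affIdeal hj).2
    (h.hasBoundedReduction hj ((mem_points_homIdeal (h.isBorelClosed hj)).1 hc))

theorem bijOn_comp_idx (h : IsTruncatedHomogenization j m J) (hj : IsBorelClosed j) :
    Set.BijOn (fun c : HomIdx J → A => c ∘ h.idx) (points (homIdeal J) A)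
      (points (affIdeal j m) A) := by
  have hJ := h.isBorelClosed hj
  refine ⟨fun c hc => h.comp_idx_mem_points hj hc, fun c hc c' hc' heq => ?_, fun b hb => ?_⟩
  · exact h.eq_of_comp_idx_eq hj ((mem_points_homIdeal hJ).1 hc)
      ((mem_points_homIdeal hJ).1 hc') heq
  · obtain ⟨c, hc, rfl⟩ := h.exists_comp_idx_eq ((mem_points_affIdeal hj).1 hb)
    exact ⟨c, (mem_points_homIdeal hJ).2 hc, rfl⟩

end IsTruncatedHomogenization

end Points

/-! ### From points to coordinate rings and schemes. -/

section Schemes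

variable {K : Type u} [Field K] {C C' : Type}

/-- The point of the closed subscheme defined by `a` with values in its coordinate ring. -/
noncomputable def universalPoint (a : Ideal (MvPolynomial C K)) : C → MvPolynomial C K ⧸ a :=
  fun i => Ideal.Quotient.mk a (X i)

theorem aeval_universalPoint (a : Ideal (MvPolynomial C K)) (p : MvPolynomial C K) :
    aeval (universalPoint a) p = Ideal.Quotient.mk a p := by
  have : aeval (universalPoint a) = Ideal.Quotient.mkₐ K a := by
    ext i
    simp [universalPoint]
  rw [this]
  rfl

theorem universalPoint_mem_points (a : Ideal (MvPolynomial C K)) :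
    universalPoint a ∈ points a (MvPolynomial C K ⧸ a) := fun p hp => by
  rw [aeval_universalPoint]
  exact Ideal.Quotient.eq_zero_iff_mem.2 hp

theorem comp_mem_points {a : Ideal (MvPolynomial C K)} {A A' : Type*} [CommRing A] [Algebra K A]
    [CommRing A'] [Algebra K A'] (φ : A →ₐ[K] A') {c : C → A} (hc : c ∈ points a A) :
    φ ∘ c ∈ points a A' := fun p hp => by
  have h1 : aeval (φ ∘ c) p = φ (aeval c p) := (comp_aeval_apply c φ p).symm
  rw [h1, hc p hp, map_zero]

/-- If composition with `ι` is a bijection of the points of two closed subschemes of affine spaces,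
then `rename ι` induces an isomorphism of their coordinate rings. -/
theorem exists_algEquiv_of_bijOn_points {a : Ideal (MvPolynomial C K)}
    {a' : Ideal (MvPolynomial C' K)} (ι : C → C')
    (h : ∀ (A : Type u) [CommRing A] [Algebra K A],
      Set.BijOn (fun c : C' → A => c ∘ ι) (points a' A) (points a A)) :
    ∃ e : (MvPolynomial C K ⧸ a) ≃ₐ[K] (MvPolynomial C' K ⧸ a'),
      ∀ p, e (Ideal.Quotient.mk a p) = Ideal.Quotient.mk a' (rename ι p) := by
  have hu := universalPoint_mem_points a'
  -- The point over the universal point of `a` defines the inverse ring map `g`.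
  obtain ⟨c, hc, hcι⟩ := (h _).surjOn (universalPoint_mem_points a)
  have hcι' : c ∘ ι = universalPoint a := hcι
  let f : (MvPolynomial C K ⧸ a) →ₐ[K] (MvPolynomial C' K ⧸ a') :=
    Ideal.Quotient.liftₐ a (aeval (universalPoint a' ∘ ι)) ((h _).mapsTo hu)
  let g : (MvPolynomial C' K ⧸ a') →ₐ[K] (MvPolynomial C K ⧸ a) :=
    Ideal.Quotient.liftₐ a' (aeval c) hc
  have hf : ∀ p, f (Ideal.Quotient.mk a p) = Ideal.Quotient.mk a' (rename ι p) := fun p => by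
    have h1 : f (Ideal.Quotient.mk a p) = aeval (universalPoint a' ∘ ι) p := rfl
    rw [h1, ← aeval_rename, aeval_universalPoint]
  have hg : ∀ p, g (Ideal.Quotient.mk a' p) = aeval c p := fun _ => rfl
  -- Both points have the same projection, so injectivity over the coordinate ring of `a'`
  -- identifies them; this makes `f` and `g` inverse.
  have hfc : f ∘ c = universalPoint a' := by
    refine (h _).injOn (comp_mem_points f hc) hu ?_
    change f ∘ (c ∘ ι) = _
    rw [hcι']
    funext i
    simp [universalPoint, hf]
  refine ⟨AlgEquiv.ofAlgHom f g ?_ ?_, hf⟩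
  · apply AlgHom.ext
    intro x
    obtain ⟨p, rfl⟩ := Ideal.Quotient.mk_surjective x
    rw [AlgHom.comp_apply, hg, comp_aeval_apply]
    change aeval (f ∘ c) p = _
    rw [hfc, aeval_universalPoint]
    rfl
  · apply AlgHom.ext
    intro x
    obtain ⟨p, rfl⟩ := Ideal.Quotient.mk_surjective x
    rw [AlgHom.comp_apply, hf, hg, aeval_rename, hcι', aeval_universalPoint]
    rfl

theorem exists_schemeIso {a : Ideal (MvPolynomial C K)} {a' : Ideal (MvPolynomial C' K)}
    {ι : C → C'} (e : (MvPolynomial C K ⧸ a) ≃ₐ[K] (MvPolynomial C' K ⧸ a'))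
    (he : ∀ p, e (Ideal.Quotient.mk a p) = Ideal.Quotient.mk a' (rename ι p)) :
    ∃ f : closedSubscheme a' ≅ closedSubscheme a,
      f.hom ≫ closedSubschemeEmb a = closedSubschemeEmb a' ≫ coordProjection K ι := by
  refine ⟨Scheme.Spec.mapIso (RingEquiv.toCommRingCatIso e.toRingEquiv).op, ?_⟩
  change Spec.map (CommRingCat.ofHom _) ≫ Spec.map _ = Spec.map _ ≫ Spec.map _
  rw [← Spec.map_comp, ← Spec.map_comp]
  congr 1
  exact CommRingCat.hom_ext (RingHom.ext he)

theorem eq_comap_rename {a : Ideal (MvPolynomial C K)} {a' : Ideal (MvPolynomial C' K)}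
    {ι : C → C'} (e : (MvPolynomial C K ⧸ a) ≃ₐ[K] (MvPolynomial C' K ⧸ a'))
    (he : ∀ p, e (Ideal.Quotient.mk a p) = Ideal.Quotient.mk a' (rename ι p)) :
    a = a'.comap (rename ι : MvPolynomial C K →ₐ[K] MvPolynomial C' K) := by
  ext p
  rw [Ideal.mem_comap, ← Ideal.Quotient.eq_zero_iff_mem, ← Ideal.Quotient.eq_zero_iff_mem, ← he,
    map_eq_zero_iff e e.injective]

end Schemes

end MarkedFamily
theorem mainTheorem5 {K : Type u} [Field K] {n : ℕ} (j : Ideal (MvPolynomial (Fin n) K))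
    (hj : MarkedFamily.IsStronglyStable j) (m : ℕ) (hm : 0 < m)
    (J : Ideal (MvPolynomial (Fin (n + 1)) K))
    (hJ : J = MarkedFamily.truncation (MarkedFamily.homogenizationIdeal j) m) :
    -- the closed subscheme defined by `𝔄` parametrizes the `[j,m]`-marked family
    (∀ (A : Type v) [CommRing A] [Algebra K A],
      Set.BijOn (fun c : MarkedFamily.AffIdx j m → A => MarkedFamily.markedIdeal c)
        (MarkedFamily.points (MarkedFamily.affIdeal j m) A) (MarkedFamily.affFamily j m A)) ∧
    -- the scheme `Mf(J)` parametrizes the `J`-marked family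
    (∀ (A : Type v) [CommRing A] [Algebra K A],
      Set.BijOn (fun c : MarkedFamily.HomIdx J → A => MarkedFamily.markedIdeal c)
        (MarkedFamily.points (MarkedFamily.homIdeal J) A) (MarkedFamily.homFamily J A)) ∧
    -- the two families correspond by homogenization and dehomogenization
    (∀ (A : Type v) [CommRing A] [Algebra K A],
      Set.BijOn (fun I => MarkedFamily.truncation (MarkedFamily.homogenizationIdeal I) m)
        (MarkedFamily.affFamily j m A) (MarkedFamily.homFamily J A) ∧
      Set.InvOn MarkedFamily.dehomogenizationIdeal
        (fun I => MarkedFamily.truncation (MarkedFamily.homogenizationIdeal I) m)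
        (MarkedFamily.affFamily j m A) (MarkedFamily.homFamily J A)) ∧
    -- the variable `C_{αγ}` is identified with the coefficient of `x₀^{d-|γ|} x^γ` in the polynomial
    -- with head term `x₀^{d-|α|} x^α`, where `d = max {m, |α|}`
    ∃ ι : MarkedFamily.AffIdx j m → MarkedFamily.HomIdx J,
      (∀ p : MarkedFamily.AffIdx j m,
        (ι p).1.1 = Finsupp.cons (max m (p.1.1).degree - (p.1.1).degree) p.1.1 ∧
        (ι p).2.1 = Finsupp.cons (max m (p.1.1).degree - (p.2.1).degree) p.2.1) ∧
      -- the projection onto these coordinates restricts to an isomorphism of schemes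
      (∃ e : MarkedFamily.homScheme J ≅ MarkedFamily.affScheme j m,
        e.hom ≫ MarkedFamily.closedSubschemeEmb (MarkedFamily.affIdeal j m) =
          MarkedFamily.closedSubschemeEmb (MarkedFamily.homIdeal J) ≫
            MarkedFamily.coordProjection K ι) ∧
      -- and `𝔄` is the ideal that defines `Mf(J)` in the smaller affine space
      MarkedFamily.affIdeal j m =
        (MarkedFamily.homIdeal J).comap (rename ι : _ →ₐ[K] _) ∧
      -- on points, this isomorphism is the correspondence of the two families
      ∀ (A : Type v) [CommRing A] [Algebra K A],
        ∀ c ∈ MarkedFamily.points (MarkedFamily.homIdeal J) A,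
          c ∘ ι ∈ MarkedFamily.points (MarkedFamily.affIdeal j m) A ∧
          MarkedFamily.truncation
              (MarkedFamily.homogenizationIdeal (MarkedFamily.markedIdeal (c ∘ ι))) m =
            MarkedFamily.markedIdeal c := by
  have h : MarkedFamily.IsTruncatedHomogenization j m J :=
    hJ ▸ MarkedFamily.isTruncatedHomogenization
  have hB := hj.isBorelClosed
  -- Only algebras in the universe of `K` are tested here, since both coordinate rings live there.
  obtain ⟨e, he⟩ := MarkedFamily.exists_algEquiv_of_bijOn_points h.idx
    fun A _ _ => h.bijOn_comp_idx (A := A) hB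
  refine ⟨fun A _ _ => h.bijOn_affFamily hB, fun A _ _ => h.bijOn_homFamily hB,
    fun A _ _ => ⟨h.bijOn_truncation hB, h.invOn_truncation hB⟩, h.idx,
    fun p => ⟨rfl, rfl⟩, MarkedFamily.exists_schemeIso e he, MarkedFamily.eq_comap_rename e he,
    fun A _ _ c hc => ⟨h.comp_idx_mem_points hB hc, ?_⟩⟩
  exact h.truncation_homogenizationIdeal_markedIdeal hB
    ((MarkedFamily.mem_points_homIdeal (h.isBorelClosed hB)).1 hc)
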